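/- Let $n \in \mathbb{N}$. Let $\mathfrak{D}_n$ be the $n$-th level of the difference hierarchy over the open subsets of $\{0,1\}^{\mathbb{N}}$: the sets $D$ for which there are open sets $U_0,\dots,U_{n-1}$ such that $x \in D$ iff $\min(\{i<n \mid x \in U_i\}\cup\{n\})$ and $n$ have different parity; a name of $D$ consists of names of $n$ such open sets, where an open set is named by an enumeration of basic cylinders whose union it is. Let $\overline{\mathfrak{D}_n}$ be the class of complements, a name of a set being a name of its complement; a name of a set in $\mathfrak{D}_n \cup \overline{\mathfrak{D}_n}$ also says in which of the two classes it is presented. Consider infinite sequential games with two players, choices in $\{0,1\}$, a turn function $d : \{0,1\}^* \to \{a,b\}$, a finite non-empty set of outcomes, an outcome function $v : \{0,1\}^{\mathbb{N}} \to O$, and linear preferences of the two players on $O$ that are inverse to each other, such that for each player and each upper set $U \subseteq O$ of that player's preference the set $v^{-1}(U)$ belongs to $\mathfrak{D}_n \cup \overline{\mathfrak{D}_n}$. Such a game is represented by the number of outcomes, look-up tables for $d$ and the preferences, and names of all these sets $v^{-1}(U)$. Let $\mathrm{SPE}_{\mathfrak{D}_n \cup \overline{\mathfrak{D}_n}}$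 be the multivalued function that maps such a game to its subgame-perfect equilibria, i.e. to the strategy profiles $\sigma : \{0,1\}^* \to \{0,1\}$ such that from every history no player can obtain an outcome that he strictly prefers by changing only his own strategy. Let $\lim(p)(m) = \lim_{i\to\infty} p(\langle m,i\rangle)$ be the limit operator on Baire space. Let $\lim^{(n)}$ be its $n$-fold composition with itself ($\lim^{(0)} = \mathrm{id}_{\mathbb{N}^{\mathbb{N}}}$); it represents the $n$-fold iterated compositional product of $\lim$, defined by $\lim^{(0)} \equiv_{\mathrm{W}} \mathrm{id}_{\mathbb{N}^{\mathbb{N}}}$, $\lim^{(k+1)} \equiv_{\mathrm{W}} \lim^{(k)} \star \lim$, where $f \star g$ is the maximal Weihrauch degree among all $f_0 \circ g_0$ with $f_0 \equiv_{\mathrm{W}} f$ and $g_0 \equiv_{\mathrm{W}} g$. Then every game as above has a subgame-perfect equilibrium, and $$\mathrm{SPE}_{\mathfrak{D}_n \cup \overline{\mathfrak{D}_n}} \equiv_{\mathrm{W}} \lim\nolimits^{(n)}.$$ -/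

import Mathlib

open Filter

/-! ### Represented spaces and computability on Baire space -/

/-- Baire space. -/
abbrev Baire : Type := ℕ → ℕ

/-- Cantor space. -/
abbrev Cantor : Type := ℕ → Bool

/-- The initial segment `p 0, …, p (k - 1)`. -/
def Baire.initSeg (p : Baire) (k : ℕ) : List ℕ := (List.range k).map p

/-- The pair `⟨p, q⟩`: `p` on the even and `q` on the odd positions. -/
def Baire.join (p q : Baire) : Baire := fun n => if n % 2 = 0 then p (n / 2) else q (n / 2)

/-- The `m`-th component of `p`, read as a sequence of points of Baire space. -/
def Baire.sec (p : Baire) (m : ℕ) : Baire := fun j => p (Nat.pair m j)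

/-- A partial function on Baire space is computable if a single algorithm computes the value
`F p n` from `n` and a sufficiently long finite part of the oracle `p`, for every `p` in the
domain of `F`. On input `w`, `n` the algorithm `φ` either has no answer yet or gives an answer;
along a point `p` of the domain it eventually answers, and its answers are correct. -/
def ComputableOnBaire (F : Baire →. Baire) : Prop :=
  ∃ φ : List ℕ → ℕ → Option ℕ, Computable₂ φ ∧
    ∀ p, ∀ q ∈ F p, ∀ n,
      (∃ k, φ (p.initSeg k) n = some (q n)) ∧
      (∀ k m, φ (p.initSeg k) n = some m → m = q n)

/-- A represented space: a set with a partial surjection from Baire space onto it, given by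
its graph. `Names p x` says that `p` is a name of `x`. -/
structure RepresentedSpace where
  Carrier : Type
  Names : Baire → Carrier → Prop
  names_unique : ∀ p x y, Names p x → Names p y → x = y
  names_surj : ∀ x, ∃ p, Names p x

/-- A partial multivalued function between represented spaces. -/
def MultiFun (X Y : RepresentedSpace) : Type := X.Carrier → Set Y.Carrier

namespace MultiFun

variable {X Y Z W : RepresentedSpace}

/-- The domain of a partial multivalued function. -/
def dom (f : MultiFun X Y) : Set X.Carrier := {x | (f x).Nonempty}

/-- Composition: `x` is in the domain of `f ∘ g` iff `x ∈ dom g` and `g x ⊆ dom f`, and then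
`(f ∘ g) x` is the union of the sets `f y` with `y ∈ g x`. -/
def comp (f : MultiFun Y Z) (g : MultiFun X Y) : MultiFun X Z :=
  fun x => {z | g x ⊆ f.dom ∧ ∃ y ∈ g x, z ∈ f y}

/-- `F` is a realizer of `f`. -/
def IsRealizer (F : Baire →. Baire) (f : MultiFun X Y) : Prop :=
  ∀ p x, X.Names p x → x ∈ f.dom → ∃ q ∈ F p, ∃ y ∈ f x, Y.Names q y

/-- Weihrauch reducibility: there are computable `K`, `H` such that `K ⟨id, G H⟩` is a realizer
of `f` whenever `G` is a realizer of `g`. -/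
def WeihrauchLE (f : MultiFun X Y) (g : MultiFun Z W) : Prop :=
  ∃ K H : Baire →. Baire, ComputableOnBaire K ∧ ComputableOnBaire H ∧
    ∀ G : Baire →. Baire, IsRealizer G g →
      IsRealizer (fun p => (H p).bind fun r => (G r).bind fun s => K (Baire.join p s)) f

/-- Weihrauch equivalence. -/
def WeihrauchEquiv (f : MultiFun X Y) (g : MultiFun Z W) : Prop :=
  WeihrauchLE f g ∧ WeihrauchLE g f

/-- `h` belongs to the degree `f ⋆ g`, the maximum of the degrees of all compositions `f₀ ∘ g₀`
with `f₀` equivalent to `f` and `g₀` equivalent to `g`. -/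
def IsStar {A B : RepresentedSpace} (f : MultiFun X Y) (g : MultiFun Z W) (h : MultiFun A B) :
    Prop :=
  (∃ (P Q R : RepresentedSpace) (f₀ : MultiFun Q R) (g₀ : MultiFun P Q),
    WeihrauchEquiv f₀ f ∧ WeihrauchEquiv g₀ g ∧ WeihrauchEquiv h (f₀.comp g₀)) ∧
  (∀ (P Q R : RepresentedSpace) (f₀ : MultiFun Q R) (g₀ : MultiFun P Q),
    WeihrauchEquiv f₀ f → WeihrauchEquiv g₀ g → WeihrauchLE (f₀.comp g₀) h)

end MultiFun

/-- Baire space, represented by the identity. -/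
def baireSpace : RepresentedSpace where
  Carrier := Baire
  Names p x := p = x
  names_unique _ _ _ h₁ h₂ := h₁.symm.trans h₂
  names_surj x := ⟨x, rfl⟩

/-- The identity on Baire space. -/
def idBaire : MultiFun baireSpace baireSpace := fun p => {q | q = p}

/-- The limit operator, `lim p n = lim_{i → ∞} p ⟨n, i⟩`, defined where all these limits exist. -/
def limBaire : MultiFun baireSpace baireSpace :=
  fun p => {q : Baire | ∀ n, ∀ᶠ i in atTop, Baire.sec p n i = q n}

/-- The `n`-fold composition of the limit operator with itself. -/
def limPow : ℕ → MultiFun baireSpace baireSpace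
  | 0 => idBaire
  | n + 1 => (limPow n).comp limBaire

/-- `h` belongs to the degree `f⁽ⁿ⁾`, where `f⁽⁰⁾` is the degree of the identity on Baire space
and `f⁽ⁿ⁺¹⁾ = f⁽ⁿ⁾ ⋆ f`. -/
def IsStarPower {X Y : RepresentedSpace} (f : MultiFun X Y) :
    ℕ → ∀ {Z W : RepresentedSpace}, MultiFun Z W → Prop
  | 0, _, _, h => h.WeihrauchEquiv idBaire
  | n + 1, _, _, h => ∃ (A B : RepresentedSpace) (h' : MultiFun A B),
      IsStarPower f n h' ∧ MultiFun.IsStar h' f h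

/-! ### The difference hierarchy over the open subsets of Cantor space -/

/-- The set of all infinite sequences with prefix `w`. -/
def cylinder (w : List Bool) : Set Cantor := {x | ∀ i (h : i < w.length), x i = w[i]}

/-- The open set with name `p`: the union of all cylinders enumerated by `p`. The entry `0`
enumerates nothing. -/
def openOfName (p : Baire) : Set Cantor :=
  {x | ∃ (i : ℕ) (w : List Bool), p i = Encodable.encode w + 1 ∧ x ∈ cylinder w}

open Classical in
/-- The least `i < n` with `x ∈ U i`, and `n` if there is none. -/
noncomputable def firstIndex (n : ℕ) (U : ℕ → Set Cantor) (x : Cantor) : ℕ :=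
  if h : ∃ i, i < n ∧ x ∈ U i then Nat.find h else n

/-- The set defined from the family `U 0, …, U (n - 1)`: those `x` for which the least index of a
member containing `x` (or `n`, if there is none) has another parity than `n`. -/
def diffSet (n : ℕ) (U : ℕ → Set Cantor) : Set Cantor :=
  {x | firstIndex n U x % 2 ≠ n % 2}

/-- The class `D n` of the difference hierarchy. -/
def diffClass (n : ℕ) : Set (Set Cantor) :=
  {D | ∃ U : ℕ → Set Cantor, (∀ i, i < n → IsOpen (U i)) ∧ D = diffSet n U}

/-- The class of the sets that are in `D n` or have their complement in `D n`. -/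
def diffOrCodiffClass (n : ℕ) : Set (Set Cantor) :=
  {A | A ∈ diffClass n ∨ Aᶜ ∈ diffClass n}

/-- A name of a set in `D n` consists of names of `n` open sets defining it. -/
def diffOfName (n : ℕ) (p : Baire) : Set Cantor := diffSet n fun i => openOfName (p.sec i)

/-- A name of a set in the union of `D n` and its dual class first tells in which of the two
classes the set is presented (`0` for `D n`); the rest is a name of the set, or of its
complement, as a member of `D n`. -/
def diffOrCodiffOfName (n : ℕ) (p : Baire) : Set Cantor :=
  if p 0 = 0 then diffOfName n fun j => p (j + 1) else (diffOfName n fun j => p (j + 1))ᶜ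

theorem exists_open_name {U : Set Cantor} (hU : IsOpen U) : ∃ p, openOfName p = U := by
  classical
  refine ⟨fun i => if ∃ w : List Bool, Encodable.encode w = i ∧ cylinder w ⊆ U then i + 1 else 0,
    ?_⟩
  ext x
  constructor
  · rintro ⟨i, w, h, hx⟩
    dsimp only at h
    split_ifs at h with hw
    obtain ⟨w', rfl, hs⟩ := hw
    obtain rfl : w' = w := Encodable.encode_injective (Nat.succ.inj h)
    exact hs hx
  · intro hx
    obtain ⟨_, ⟨y, k, rfl⟩, hxy, hs⟩ :=
      (PiNat.isTopologicalBasis_cylinders (fun _ : ℕ => Bool)).exists_subset_of_mem_open hx hU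
    have e : cylinder (List.ofFn fun i : Fin k => y i) = PiNat.cylinder y k := by
      ext z
      simp [cylinder, PiNat.cylinder]
    rw [← e] at hs hxy
    exact ⟨_, _, if_pos ⟨_, rfl, hs⟩, hxy⟩

theorem diffSet_congr {n : ℕ} {U V : ℕ → Set Cantor} (h : ∀ i, i < n → U i = V i) :
    diffSet n U = diffSet n V := by
  have key : ∀ x, firstIndex n U x = firstIndex n V x := by
    intro x
    have hp : (fun i => i < n ∧ x ∈ U i) = fun i => i < n ∧ x ∈ V i :=
      funext fun i => propext (and_congr_right fun hi => by rw [h i hi])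
    unfold firstIndex
    congr!
  simp only [diffSet, key]

theorem exists_diff_name {n : ℕ} {A : Set Cantor} (hA : A ∈ diffClass n) :
    ∃ p, diffOfName n p = A := by
  obtain ⟨U, hU, rfl⟩ := hA
  have : ∀ i, ∃ q, i < n → openOfName q = U i := by
    intro i
    by_cases hi : i < n
    · obtain ⟨q, hq⟩ := exists_open_name (hU i hi)
      exact ⟨q, fun _ => hq⟩
    · exact ⟨fun _ => 0, fun h => absurd h hi⟩
  choose q hq using this
  refine ⟨fun j => q j.unpair.1 j.unpair.2, diffSet_congr fun i hi => ?_⟩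
  rw [← hq i hi]
  congr 1
  funext j
  simp [Baire.sec]

theorem exists_diffOrCodiff_name {n : ℕ} {A : Set Cantor} (hA : A ∈ diffOrCodiffClass n) :
    ∃ p, diffOrCodiffOfName n p = A := by
  rcases hA with hA | hA
  · obtain ⟨p, hp⟩ := exists_diff_name hA
    exact ⟨fun j => j.casesOn 0 p, by simpa [diffOrCodiffOfName] using hp⟩
  · obtain ⟨p, hp⟩ := exists_diff_name hA
    exact ⟨fun j => j.casesOn 1 p, by simp [diffOrCodiffOfName, hp]⟩

/-! ### Games -/

/-- Infinite sequential games with choices in `{0,1}`, two players (`false` is the first and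
`true` the second), finitely many outcomes, and antagonistic linear preferences.
`pref a o o'` means that player `a` strictly prefers `o'` to `o`. -/
structure Game where
  numOutcomes : ℕ
  outcomes_nonempty : 0 < numOutcomes
  turn : List Bool → Bool
  pref : Bool → Fin numOutcomes → Fin numOutcomes → Prop
  pref_linear : ∀ a, IsStrictTotalOrder (Fin numOutcomes) (pref a)
  antagonistic : ∀ o o', pref true o o' ↔ pref false o' o
  val : Cantor → Fin numOutcomes

namespace Game

/-- `U` is an upper set of outcomes with respect to the preference of player `a`. -/
def IsUpper (G : Game) (a : Bool) (U : Set (Fin G.numOutcomes)) : Prop :=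
  ∀ o o', o ∈ U → G.pref a o o' → o' ∈ U

/-- Every upper set of outcomes, for either player, comes from a set of plays that is in `D n`
or has its complement in `D n`. -/
def InClass (n : ℕ) (G : Game) : Prop :=
  ∀ a U, G.IsUpper a U → G.val ⁻¹' U ∈ diffOrCodiffClass n

/-- The history reached from `w` after `n` further moves of the strategy profile `s`. -/
def historyFrom (s : List Bool → Bool) (w : List Bool) : ℕ → List Bool
  | 0 => w
  | n + 1 => historyFrom s w n ++ [s (historyFrom s w n)]

/-- The play induced by the strategy profile `s` starting at the history `w`. -/
def play (s : List Bool → Bool) (w : List Bool) : Cantor :=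
  fun i => (historyFrom s w (i + 1)).getD i false

/-- `s` is a Nash equilibrium of `G` started at the history `w`: no player `a` prefers the
outcome of a profile that differs from `s` only in the strategy of `a`. -/
def IsNashFrom (G : Game) (w : List Bool) (s : List Bool → Bool) : Prop :=
  ∀ (a : Bool) (s' : List Bool → Bool), (∀ u, G.turn u ≠ a → s' u = s u) →
    ¬ G.pref a (G.val (play s w)) (G.val (play s' w))

/-- Subgame-perfect equilibria. -/
def IsSubgamePerfect (G : Game) (s : List Bool → Bool) : Prop := ∀ w, G.IsNashFrom w s

/-- The set of outcomes with bit mask `m`. -/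
def maskSet (k m : ℕ) : Set (Fin k) := {o | m.testBit o = true}

open Classical in
/-- `p` is a name of `G`. Its components are: the number of outcomes; the look-up table of the
players' turns; the look-up tables of the preferences; and, for each player and each upper set
of outcomes of that player (given by its bit mask), a name of the set of plays resulting in it
as a member of the union of `D n` and its dual class. -/
def Names (n : ℕ) (p : Baire) (G : Game) : Prop :=
  p.sec 0 0 = G.numOutcomes ∧
  (∀ w, p.sec 1 (Encodable.encode w) = (G.turn w).toNat) ∧
  (∀ a (o o' : Fin G.numOutcomes),
    p.sec 2 (Nat.pair a.toNat (Nat.pair o o')) = if G.pref a o o' then 1 else 0) ∧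
  (∀ a m, m < 2 ^ G.numOutcomes → G.IsUpper a (maskSet G.numOutcomes m) →
    diffOrCodiffOfName n ((p.sec 3).sec (Nat.pair a.toNat m)) =
      G.val ⁻¹' maskSet G.numOutcomes m)

theorem exists_mask {k : ℕ} (U : Set (Fin k)) : ∃ m, m < 2 ^ k ∧ maskSet k m = U := by
  classical
  refine ⟨Nat.ofBits fun i : Fin k => decide (i ∈ U), Nat.ofBits_lt_two_pow _, ?_⟩
  ext o
  simp [maskSet]

theorem names_unique (n : ℕ) (p : Baire) (G G' : Game) (h : Names n p G) (h' : Names n p G') :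
    G = G' := by
  obtain ⟨k, hk, d, r, hr, ha, v⟩ := G
  obtain ⟨k', hk', d', r', hr', ha', v'⟩ := G'
  obtain ⟨h0, h1, h2, h3⟩ := h
  obtain ⟨h0', h1', h2', h3'⟩ := h'
  dsimp only at *
  obtain rfl : k = k' := h0.symm.trans h0'
  obtain rfl : d = d' := by
    funext w
    have := (h1 w).symm.trans (h1' w)
    revert this
    cases d w <;> cases d' w <;> simp
  obtain rfl : r = r' := by
    funext a o o'
    have := (h2 a o o').symm.trans (h2' a o o')
    by_cases hA : r a o o' <;> by_cases hB : r' a o o' <;> simp_all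
  obtain rfl : v = v' := by
    funext x
    have key : ∀ o o₁ : Fin k, (∀ U : Set (Fin k), (∀ o o', o ∈ U → r false o o' → o' ∈ U) →
        (o ∈ U ↔ o₁ ∈ U)) → o = o₁ := by
      intro o o₁ hU
      have hs := hr false
      have h₁ := hU {b | b = o ∨ r false o b} (by
        rintro b b' (rfl | hb) hbb
        · exact Or.inr hbb
        · exact Or.inr (_root_.trans hb hbb))
      have h₂ := hU {b | b = o₁ ∨ r false o₁ b} (by
        rintro b b' (rfl | hb) hbb
        · exact Or.inr hbb
        · exact Or.inr (_root_.trans hb hbb))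
      rcases h₁.1 (Or.inl rfl) with e | e
      · exact e.symm
      · rcases h₂.2 (Or.inl rfl) with e' | e'
        · exact e'
        · exact absurd (_root_.trans e e') (irrefl_of (r false) o)
    refine key _ _ fun U hU => ?_
    obtain ⟨m, hm, rfl⟩ := exists_mask U
    have := (h3 false m hm hU).symm.trans (h3' false m hm hU)
    exact Set.ext_iff.1 this x
  rfl

theorem names_surj (n : ℕ) (G : Game) (hG : G.InClass n) : ∃ p, Names n p G := by
  classical
  have hset : ∀ a m, ∃ q, G.IsUpper a (maskSet G.numOutcomes m) →
      diffOrCodiffOfName n q = G.val ⁻¹' maskSet G.numOutcomes m := by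
    intro a m
    by_cases h : G.IsUpper a (maskSet G.numOutcomes m)
    · obtain ⟨q, hq⟩ := exists_diffOrCodiff_name (hG a _ h)
      exact ⟨q, fun _ => hq⟩
    · exact ⟨fun _ => 0, fun h' => absurd h' h⟩
  choose q hq using hset
  let tb : ℕ → Bool := fun i => decide (i = 1)
  have htb : ∀ a : Bool, tb a.toNat = a := by intro a; cases a <;> simp [tb]
  let p : Baire := fun j =>
    match j.unpair.1 with
    | 0 => G.numOutcomes
    | 1 => ((Encodable.decode (α := List Bool) j.unpair.2).elim false G.turn).toNat
    | 2 =>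
      let a := tb j.unpair.2.unpair.1
      let i := j.unpair.2.unpair.2.unpair.1
      let i' := j.unpair.2.unpair.2.unpair.2
      if ∃ o o' : Fin G.numOutcomes, (o : ℕ) = i ∧ (o' : ℕ) = i' ∧ G.pref a o o' then 1 else 0
    | _ => q (tb j.unpair.2.unpair.1.unpair.1) j.unpair.2.unpair.1.unpair.2 j.unpair.2.unpair.2
  refine ⟨p, ?_, ?_, ?_, ?_⟩
  · simp [p, Baire.sec]
  · intro w
    simp [p, Baire.sec]
  · intro a o o'
    simp only [p, Baire.sec, Nat.unpair_pair, htb]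
    refine if_congr ⟨?_, fun h => ⟨o, o', rfl, rfl, h⟩⟩ rfl rfl
    rintro ⟨b, b', hb, hb', h⟩
    rwa [Fin.ext hb, Fin.ext hb'] at h
  · intro a m _ h
    rw [← hq a m h]
    congr 1
    funext j
    simp [p, Baire.sec, htb]

end Game

/-- The represented space of all games whose upper outcome sets are in the union of `D n` and its
dual class. -/
def gameSpace (n : ℕ) : RepresentedSpace where
  Carrier := {G : Game // G.InClass n}
  Names p G := Game.Names n p G.1
  names_unique p G G' h h' := Subtype.ext (Game.names_unique n p G.1 G'.1 h h')
  names_surj G := Game.names_surj n G.1 G.2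

/-- The represented space of strategy profiles, as points of Cantor space indexed by words. -/
def profileSpace : RepresentedSpace where
  Carrier := List Bool → Bool
  Names p s := ∀ w, p (Encodable.encode w) = (s w).toNat
  names_unique p s s' h h' := by
    funext w
    have := (h w).symm.trans (h' w)
    revert this
    cases s w <;> cases s' w <;> simp
  names_surj s := ⟨fun j => ((Encodable.decode (α := List Bool) j).elim false s).toNat, by simp⟩

/-- Finding subgame-perfect equilibria. -/
def SPE (n : ℕ) : MultiFun (gameSpace n) profileSpace := fun G => {s | G.1.IsSubgamePerfect s}

/-! ### Computability relative to a point of Baire space -/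

/-! Upper bound. A presentation by open sets `U 0, …, U (n - 1)` gives each history a level: the
least index of an open set already seen to contain its cylinder, or `n`. Levels never increase along
a play, and the final level alone decides who wins the two-outcome game. Call one player favoured at
level `l` if he wins the plays of final level `l`. From a history of level `l` his opponent wins
exactly if he can force a lower level at a history from which he wins. This is a reachability
condition, so it is witnessed by a finite set of words. Once the lower levels are settled, one limit
finds the least witness; at level `0` there is none. Hence `n` nested limits settle all histories
for all outcome sets at once (`iterate_leastCert_succ`, `tableOf_limComputable`). Following least
witnesses wins (`solves_levels`): their codes never grow, so a play that did not leave its level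
would end up inside one finite set of words.

Since the preferences are opposed and there are finitely many outcomes, every history has a value
that both players can guarantee (`Game.exists_value`). Playing the winning strategy for the current
value is subgame-perfect (`Game.isSubgamePerfect_of_solves`): the value never moves against a player
who does so, it stabilises, and from then on one fixed strategy is followed.

The degree calculus rests on `exists_lim_comm`: a computable step after a limit can be carried out
before it, on the approximations. So the relations given by a computable step and `n` limits absorb
computable post-processing and compose additively, which also identifies `limPow n` with the
iterated compositional product.

Lower bound. For `n > 0` let `y` be the `(n - 1)`-fold limit of `p` and `q` the limit of `y`. That
`y ⟨m, i⟩ ≠ k` for some `i ≥ t` is a statement about `p` with `n` alternating quantifiers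
(`truth_succ_iff`). The players choose the quantified numbers in unary, and whoever never stops
loses; these phases fit into `n` levels. Beforehand the first player may take a neutral outcome
instead, and in equilibrium he does so exactly if the statement is false (`strategy_eq`). Searching
for such a pair `t`, `k` then yields `q m = k` (`mem_readLimit`). For `n = 0` the input itself is
returned. -/

section Oracle

variable {α β γ δ : Type*}

/-- An algorithm whose answers on a finite word remain valid on all longer words. -/
def PrefixMono (φ : List ℕ → α → Option β) : Prop :=
  ∀ ⦃w w' : List ℕ⦄ ⦃a : α⦄ ⦃b : β⦄, w <+: w' → φ w a = some b → φ w' a = some b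

theorem Baire.initSeg_prefix (p : Baire) {k l : ℕ} (h : k ≤ l) : p.initSeg k <+: p.initSeg l := by
  obtain ⟨d, rfl⟩ := Nat.exists_eq_add_of_le h
  rw [Baire.initSeg, Baire.initSeg, List.range_add, List.map_append]
  exact List.prefix_append _ _

@[simp] theorem Baire.length_initSeg (p : Baire) (k : ℕ) : (p.initSeg k).length = k := by
  simp [Baire.initSeg]

theorem Baire.getElem?_initSeg (p : Baire) {i k : ℕ} (h : i < k) :
    (p.initSeg k)[i]? = some (p i) := by
  simp [Baire.initSeg, h]

theorem Baire.take_initSeg (p : Baire) {i k : ℕ} (h : i ≤ k) :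
    (p.initSeg k).take i = p.initSeg i := by
  simp [Baire.initSeg, ← List.map_take, List.take_range, h]

/-- The least `i < n` with `P i`, and `n` if there is none. -/
def boundedFind (P : ℕ → Bool) : ℕ → ℕ
  | 0 => 0
  | n + 1 => if boundedFind P n < n then boundedFind P n else if P n then n else n + 1

theorem boundedFind_le (P : ℕ → Bool) (n : ℕ) : boundedFind P n ≤ n := by
  induction n with
  | zero => simp [boundedFind]
  | succ n ih => simp only [boundedFind]; split_ifs <;> omega

theorem boundedFind_spec {P : ℕ → Bool} {n : ℕ} (h : boundedFind P n < n) :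
    P (boundedFind P n) = true := by
  induction n with
  | zero => simp at h
  | succ n ih =>
    simp only [boundedFind] at h ⊢
    split_ifs at h ⊢ with h₁ h₂
    · exact ih h₁
    · exact h₂
    · omega

theorem boundedFind_min {P : ℕ → Bool} {n i : ℕ} (h : i < boundedFind P n) : P i = false := by
  induction n with
  | zero => simp [boundedFind] at h
  | succ n ih =>
    simp only [boundedFind] at h
    have := boundedFind_le P n
    split_ifs at h with h₁ h₂
    · exact ih h
    · exact ih (by omega)
    · rcases Nat.lt_succ_iff_lt_or_eq.1 h with h | rfl
      · exact ih (by omega)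
      · simpa using h₂

theorem boundedFind_eq_of {P : ℕ → Bool} {n i : ℕ} (hi : i < n) (h : P i = true)
    (h' : ∀ j, j < i → P j = false) : boundedFind P n = i := by
  rcases lt_trichotomy (boundedFind P n) i with h₁ | h₁ | h₁
  · have := boundedFind_spec (h₁.trans hi)
    rw [h' _ h₁] at this
    cases this
  · exact h₁
  · rw [boundedFind_min h₁] at h
    cases h

theorem boundedFind_lt_iff {P : ℕ → Bool} {n : ℕ} :
    boundedFind P n < n ↔ ∃ i, i < n ∧ P i = true := by
  refine ⟨fun h => ⟨_, h, boundedFind_spec h⟩, ?_⟩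
  rintro ⟨i, hi, h⟩
  by_contra h'
  rw [boundedFind_min (hi.trans_le (not_lt.1 h'))] at h
  cases h

theorem boundedFind_le_of {P : ℕ → Bool} {n i : ℕ} (h : P i = true) : boundedFind P n ≤ i := by
  by_contra h'
  rw [boundedFind_min (not_le.1 h')] at h
  cases h

theorem boundedFind_congr {P Q : ℕ → Bool} {n : ℕ} (h : ∀ i, i < n → P i = Q i) :
    boundedFind P n = boundedFind Q n := by
  induction n with
  | zero => rfl
  | succ n ih =>
    simp only [boundedFind, ih fun i hi => h i (hi.trans n.lt_succ_self), h n n.lt_succ_self]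

/-! ### Closure properties of computations with an oracle -/

variable [Primcodable α] [Primcodable β] [Primcodable γ] [Primcodable δ]

/-- Functions that are computable, uniformly in an arbitrary point of Baire space. -/
def OracleComputable (f : Baire → α → β) : Prop :=
  ∃ φ : List ℕ → α → Option β, Computable₂ φ ∧ PrefixMono φ ∧
    ∀ p a, ∃ k, φ (p.initSeg k) a = some (f p a)

namespace OracleComputable

theorem of_eq {f g : Baire → α → β} (hf : OracleComputable f) (h : ∀ p a, f p a = g p a) :
    OracleComputable g := by
  obtain rfl : f = g := funext fun p => funext (h p)
  exact hf

theorem of_computable {f : α → β} (hf : Computable f) : OracleComputable fun _ a => f a :=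
  ⟨fun _ a => some (f a), (Computable.option_some.comp (hf.comp Computable.snd)).to₂,
    fun _ _ _ _ _ h => h, fun _ _ => ⟨0, rfl⟩⟩

theorem of_primrec {f : α → β} (hf : Primrec f) : OracleComputable fun _ a => f a :=
  of_computable hf.to_comp

theorem const (b : β) : OracleComputable fun _ (_ : α) => b := of_computable (Computable.const b)

protected theorem id : OracleComputable fun _ (a : α) => a := of_computable Computable.id

theorem comp {f : Baire → β → γ} {g : Baire → α → β} (hf : OracleComputable f)
    (hg : OracleComputable g) : OracleComputable fun p a => f p (g p a) := by
  obtain ⟨φ, hφ, mφ, cφ⟩ := hf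
  obtain ⟨ψ, hψ, mψ, cψ⟩ := hg
  refine ⟨fun w a => (ψ w a).bind fun b => φ w b, ?_, ?_, ?_⟩
  · exact Computable.option_bind hψ
      (hφ.comp (Computable.fst.comp Computable.fst) Computable.snd).to₂
  · intro w w' a c hw h
    obtain ⟨b, hb, hc⟩ := Option.bind_eq_some_iff.1 h
    exact Option.bind_eq_some_iff.2 ⟨b, mψ hw hb, mφ hw hc⟩
  · intro p a
    obtain ⟨k, hk⟩ := cψ p a
    obtain ⟨l, hl⟩ := cφ p (g p a)
    exact ⟨max k l, Option.bind_eq_some_iff.2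
      ⟨_, mψ (p.initSeg_prefix (le_max_left k l)) hk,
        mφ (p.initSeg_prefix (le_max_right k l)) hl⟩⟩

theorem pair {f : Baire → α → β} {g : Baire → α → γ} (hf : OracleComputable f)
    (hg : OracleComputable g) : OracleComputable fun p a => (f p a, g p a) := by
  obtain ⟨φ, hφ, mφ, cφ⟩ := hf
  obtain ⟨ψ, hψ, mψ, cψ⟩ := hg
  refine ⟨fun w a => (φ w a).bind fun b => (ψ w a).map fun c => (b, c), ?_, ?_, ?_⟩
  · refine Computable.option_bind (f := fun x : List ℕ × α => φ x.1 x.2)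
      (g := fun x b => (ψ x.1 x.2).map fun c => (b, c)) hφ ?_
    exact Computable.option_map (f := fun y : (List ℕ × α) × β => ψ y.1.1 y.1.2)
      (g := fun y c => (y.2, c)) (hψ.comp (Computable.fst.comp Computable.fst)
        (Computable.snd.comp Computable.fst))
      (Computable.pair (Computable.snd.comp Computable.fst) Computable.snd)
  · intro w w' a c hw h
    obtain ⟨b, hb, hc⟩ := Option.bind_eq_some_iff.1 h
    obtain ⟨d, hd, rfl⟩ := Option.map_eq_some_iff.1 hc
    exact Option.bind_eq_some_iff.2 ⟨b, mφ hw hb, Option.map_eq_some_iff.2 ⟨d, mψ hw hd, rfl⟩⟩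
  · intro p a
    obtain ⟨k, hk⟩ := cφ p a
    obtain ⟨l, hl⟩ := cψ p a
    exact ⟨max k l, Option.bind_eq_some_iff.2 ⟨_, mφ (p.initSeg_prefix (le_max_left k l)) hk,
      Option.map_eq_some_iff.2 ⟨_, mψ (p.initSeg_prefix (le_max_right k l)) hl, rfl⟩⟩⟩

theorem app₂ {f : Baire → β × γ → δ} {g : Baire → α → β} {h : Baire → α → γ}
    (hf : OracleComputable f) (hg : OracleComputable g) (hh : OracleComputable h) :
    OracleComputable fun p a => f p (g p a, h p a) :=
  hf.comp (hg.pair hh)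

theorem map {f : β → γ} {g : Baire → α → β} (hf : Primrec f) (hg : OracleComputable g) :
    OracleComputable fun p a => f (g p a) :=
  (of_primrec hf).comp hg

theorem map₂ {f : β → γ → δ} {g : Baire → α → β} {h : Baire → α → γ} (hf : Primrec₂ f)
    (hg : OracleComputable g) (hh : OracleComputable h) :
    OracleComputable fun p a => f (g p a) (h p a) :=
  (of_primrec (f := fun x : β × γ => f x.1 x.2) hf).comp (hg.pair hh)

theorem fst {f : Baire → α → β × γ} (hf : OracleComputable f) :
    OracleComputable fun p a => (f p a).1 := map Primrec.fst hf

theorem snd {f : Baire → α → β × γ} (hf : OracleComputable f) :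
    OracleComputable fun p a => (f p a).2 := map Primrec.snd hf

/-- Asking the oracle. -/
theorem query {f : Baire → α → ℕ} (hf : OracleComputable f) :
    OracleComputable fun p a => p (f p a) := by
  have : OracleComputable fun p (n : ℕ) => p n := by
    refine ⟨fun w n => w[n]?, Computable.list_getElem?, ?_, ?_⟩
    · rintro w _ n m ⟨t, rfl⟩ h
      dsimp only at h ⊢
      rw [List.getElem?_append_left (List.getElem?_eq_some_iff.1 h).1, h]
    · exact fun p n => ⟨n + 1, p.getElem?_initSeg n.lt_succ_self⟩
  exact this.comp hf

theorem nat_rec {f : Baire → α → β} {g : Baire → α × ℕ × β → β} {h : Baire → α → ℕ}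
    (hf : OracleComputable f) (hg : OracleComputable g) (hh : OracleComputable h) :
    OracleComputable fun p a =>
      Nat.rec (motive := fun _ => β) (f p a) (fun i b => g p (a, i, b)) (h p a) := by
  suffices H : OracleComputable fun p (x : α × ℕ) =>
      Nat.rec (motive := fun _ => β) (f p x.1) (fun i b => g p (x.1, i, b)) x.2 from
    H.comp (OracleComputable.id.pair hh)
  obtain ⟨φ, hφ, mφ, cφ⟩ := hf
  obtain ⟨ψ, hψ, mψ, cψ⟩ := hg
  have hm : PrefixMono fun w (x : α × ℕ) => Nat.rec (motive := fun _ => Option β) (φ w x.1)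
      (fun i o => o.bind fun b => ψ w (x.1, i, b)) x.2 := by
    rintro w w' ⟨a, n⟩ b hw h
    dsimp only at h ⊢
    induction n generalizing b with
    | zero => exact mφ hw h
    | succ n ih =>
      obtain ⟨c, hc, hb⟩ := Option.bind_eq_some_iff.1 h
      exact Option.bind_eq_some_iff.2 ⟨c, ih hc, mψ hw hb⟩
  refine ⟨_, ?_, hm, ?_⟩
  · refine Computable.nat_rec (f := fun y : List ℕ × α × ℕ => y.2.2)
      (g := fun y => φ y.1 y.2.1)
      (h := fun y z => z.2.bind fun b => ψ y.1 (y.2.1, z.1, b)) ?_ ?_ ?_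
    · exact Computable.snd.comp Computable.snd
    · exact hφ.comp Computable.fst (Computable.fst.comp Computable.snd)
    · refine Computable.option_bind
        (f := fun y : (List ℕ × α × ℕ) × ℕ × Option β => y.2.2)
        (g := fun y b => ψ y.1.1 (y.1.2.1, y.2.1, b)) (Computable.snd.comp Computable.snd) ?_
      exact Computable₂.comp (f := ψ)
        (g := fun y : ((List ℕ × α × ℕ) × ℕ × Option β) × β => y.1.1.1)
        (h := fun y => (y.1.1.2.1, y.1.2.1, y.2)) hψ
        (Computable.fst.comp (Computable.fst.comp Computable.fst))
        (Computable.pair (Computable.fst.comp (Computable.snd.comp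
          (Computable.fst.comp Computable.fst))) (Computable.pair
            (Computable.fst.comp (Computable.snd.comp Computable.fst)) Computable.snd))
  · rintro p ⟨a, n⟩
    dsimp only
    induction n with
    | zero => exact cφ p a
    | succ n ih =>
      obtain ⟨k, hk⟩ := ih
      obtain ⟨l, hl⟩ := cψ p (a, n, Nat.rec (f p a) (fun i b => g p (a, i, b)) n)
      exact ⟨max k l, Option.bind_eq_some_iff.2
        ⟨_, hm (a := (a, n)) (p.initSeg_prefix (le_max_left k l)) hk,
          mψ (p.initSeg_prefix (le_max_right k l)) hl⟩⟩

/-- Searching through prefixes of the zero oracle removes the oracle. The closure rules for oracle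
computations thereby also prove ordinary computability. -/
theorem computable {f : α → β} (hf : OracleComputable fun _ => f) : Computable f := by
  obtain ⟨φ, hφ, mφ, cφ⟩ := hf
  have h0 : Computable fun k : ℕ => Baire.initSeg (fun _ => 0) k :=
    (Primrec.list_map Primrec.list_range (Primrec.const 0).to₂).to_comp
  have : Partrec fun a : α => Nat.rfindOpt fun k => φ (Baire.initSeg (fun _ => 0) k) a :=
    Partrec.rfindOpt (hφ.comp (h0.comp Computable.snd) Computable.fst).to₂
  refine this.of_eq_tot fun a => ?_
  obtain ⟨k, hk⟩ := cφ (fun _ => 0) a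
  refine (Nat.rfindOpt_mono ?_).2 ⟨k, hk⟩
  exact fun {a' m n} hmn h => mφ (Baire.initSeg_prefix _ hmn) h

theorem ite {P : Baire → α → Prop} [∀ p a, Decidable (P p a)] {f g : Baire → α → β}
    (hP : OracleComputable fun p a => decide (P p a)) (hf : OracleComputable f)
    (hg : OracleComputable g) : OracleComputable fun p a => if P p a then f p a else g p a := by
  have : Primrec fun x : Bool × β × β => bif x.1 then x.2.1 else x.2.2 :=
    Primrec.cond Primrec.fst (Primrec.fst.comp Primrec.snd) (Primrec.snd.comp Primrec.snd)
  refine (map this (hP.pair (hf.pair hg))).of_eq fun p a => ?_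
  by_cases h : P p a <;> simp [h]

theorem and {P Q : Baire → α → Prop} [∀ p a, Decidable (P p a)] [∀ p a, Decidable (Q p a)]
    (hP : OracleComputable fun p a => decide (P p a))
    (hQ : OracleComputable fun p a => decide (Q p a)) :
    OracleComputable fun p a => decide (P p a ∧ Q p a) :=
  (map₂ Primrec.and hP hQ).of_eq fun p a => by simp

theorem or {P Q : Baire → α → Prop} [∀ p a, Decidable (P p a)] [∀ p a, Decidable (Q p a)]
    (hP : OracleComputable fun p a => decide (P p a))
    (hQ : OracleComputable fun p a => decide (Q p a)) :
    OracleComputable fun p a => decide (P p a ∨ Q p a) :=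
  (map₂ Primrec.or hP hQ).of_eq fun p a => by simp

theorem not {P : Baire → α → Prop} [∀ p a, Decidable (P p a)]
    (hP : OracleComputable fun p a => decide (P p a)) :
    OracleComputable fun p a => decide (¬ P p a) :=
  (map Primrec.not hP).of_eq fun p a => by simp

theorem eq [DecidableEq β] {f g : Baire → α → β} (hf : OracleComputable f)
    (hg : OracleComputable g) : OracleComputable fun p a => decide (f p a = g p a) :=
  map₂ (f := fun x y : β => decide (x = y)) Primrec.eq.decide hf hg

theorem lt {f g : Baire → α → ℕ} (hf : OracleComputable f)
    (hg : OracleComputable g) : OracleComputable fun p a => decide (f p a < g p a) :=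
  map₂ (f := fun x y : ℕ => decide (x < y)) Primrec.nat_lt.decide hf hg

theorem le {f g : Baire → α → ℕ} (hf : OracleComputable f)
    (hg : OracleComputable g) : OracleComputable fun p a => decide (f p a ≤ g p a) :=
  map₂ (f := fun x y : ℕ => decide (x ≤ y)) Primrec.nat_le.decide hf hg

theorem add {f g : Baire → α → ℕ} (hf : OracleComputable f)
    (hg : OracleComputable g) : OracleComputable fun p a => f p a + g p a :=
  map₂ Primrec.nat_add hf hg

theorem natPair {f g : Baire → α → ℕ} (hf : OracleComputable f)
    (hg : OracleComputable g) : OracleComputable fun p a => Nat.pair (f p a) (g p a) :=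
  map₂ Primrec₂.natPair hf hg

protected theorem encode {f : Baire → α → β} (hf : OracleComputable f) :
    OracleComputable fun p a => Encodable.encode (f p a) :=
  map Primrec.encode hf

theorem getD {f : Baire → α → Option β} {g : Baire → α → β} (hf : OracleComputable f)
    (hg : OracleComputable g) : OracleComputable fun p a => (f p a).getD (g p a) :=
  map₂ Primrec.option_getD hf hg

theorem boundedFind {P : Baire → α × ℕ → Bool} {h : Baire → α → ℕ} (hP : OracleComputable P)
    (hh : OracleComputable h) :
    OracleComputable fun p a => _root_.boundedFind (fun i => P p (a, i)) (h p a) := by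
  have hi : OracleComputable fun _ (x : α × ℕ × ℕ) => x.2.1 := OracleComputable.id.snd.fst
  have hb : OracleComputable fun _ (x : α × ℕ × ℕ) => x.2.2 := OracleComputable.id.snd.snd
  have hg : OracleComputable fun p (x : α × ℕ × ℕ) =>
      if x.2.2 < x.2.1 then x.2.2 else if P p (x.1, x.2.1) = true then x.2.1 else x.2.1 + 1 :=
    ite (lt hb hi) hb (ite ((hP.app₂ OracleComputable.id.fst hi).of_eq fun p a => by simp) hi
      (map Primrec.succ hi))
  refine ((const 0).nat_rec hg hh).of_eq fun p a => ?_
  induction h p a with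
  | zero => rfl
  | succ n ih => simp only [_root_.boundedFind, ← ih]

theorem map_range {P : Baire → α × ℕ → γ} {h : Baire → α → ℕ} (hP : OracleComputable P)
    (hh : OracleComputable h) :
    OracleComputable fun p a => (List.range (h p a)).map fun i => P p (a, i) := by
  have hg : OracleComputable fun p (x : α × ℕ × List γ) => x.2.2 ++ [P p (x.1, x.2.1)] :=
    map₂ (f := fun (l : List γ) c => l ++ [c]) Primrec.list_concat OracleComputable.id.snd.snd
      (hP.app₂ OracleComputable.id.fst OracleComputable.id.snd.fst)
  refine ((const []).nat_rec hg hh).of_eq fun p a => ?_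
  induction h p a with
  | zero => rfl
  | succ n ih => simp only [List.range_succ, List.map_append, ← ih, List.map_cons, List.map_nil]

theorem exists_lt {P : Baire → α × ℕ → Prop} [∀ p x, Decidable (P p x)] {h : Baire → α → ℕ}
    [∀ p a, Decidable (∃ i, i < h p a ∧ P p (a, i))]
    (hP : OracleComputable fun p x => decide (P p x)) (hh : OracleComputable h) :
    OracleComputable fun p a => decide (∃ i, i < h p a ∧ P p (a, i)) := by
  refine (lt (boundedFind hP hh) hh).of_eq fun p a => ?_
  simp [boundedFind_lt_iff]

/-- The search for a counterexample runs over indices. An index past the end yields `none`, which is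
never `some false`. -/
theorem forall_mem {P : Baire → α × γ → Prop} [∀ p x, Decidable (P p x)]
    {L : Baire → α → List γ} [∀ p a, Decidable (∀ c ∈ L p a, P p (a, c))]
    (hP : OracleComputable fun p x => decide (P p x)) (hL : OracleComputable L) :
    OracleComputable fun p a => decide (∀ c ∈ L p a, P p (a, c)) := by
  have hg : OracleComputable fun p (x : α × ℕ × Option γ) =>
      Option.map (fun c => decide (P p (x.1, c))) x.2.2 := by
    obtain ⟨φ, hφ, mφ, cφ⟩ := hP
    refine ⟨fun w x => Option.casesOn (motive := fun _ => Option (Option Bool)) x.2.2 (some none)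
      fun c => (φ w (x.1, c)).map some, ?_, ?_, ?_⟩
    · refine Computable.option_casesOn
        (o := fun y : List ℕ × α × ℕ × Option γ => y.2.2.2) (f := fun _ => some none)
        (g := fun y c => (φ y.1 (y.2.1, c)).map some)
        (Computable.snd.comp (Computable.snd.comp Computable.snd)) (Computable.const _) ?_
      refine Computable.option_map (hφ.comp (Computable.fst.comp Computable.fst) ?_)
        (Computable.option_some.comp Computable.snd).to₂
      exact Computable.pair (Computable.fst.comp (Computable.snd.comp Computable.fst))
        Computable.snd
    · rintro w w' ⟨a, i, _ | c⟩ b hw h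
      · exact h
      · obtain ⟨d, hd, rfl⟩ := Option.map_eq_some_iff.1 h
        exact Option.map_eq_some_iff.2 ⟨d, mφ hw hd, rfl⟩
    · rintro p ⟨a, i, _ | c⟩
      · exact ⟨0, rfl⟩
      · obtain ⟨k, hk⟩ := cφ p (a, c)
        exact ⟨k, Option.map_eq_some_iff.2 ⟨_, hk, rfl⟩⟩
  have hQ : OracleComputable fun p (x : α × ℕ) =>
      decide (Option.map (fun c => decide (P p (x.1, c))) (L p x.1)[x.2]? = some false) := by
    refine eq (hg.comp ((OracleComputable.id.fst).pair ((OracleComputable.id.snd).pair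
      (map₂ Primrec.list_getElem? (hL.comp OracleComputable.id.fst)
        OracleComputable.id.snd)))) (const _)
  classical
  refine (not (exists_lt hQ (map Primrec.list_length hL))).of_eq fun p a => ?_
  congr 1
  rw [eq_iff_iff, List.forall_mem_iff_getElem]
  constructor
  · intro h i hi
    by_contra hn
    exact h ⟨i, hi, by simp [hi, hn]⟩
  · rintro h ⟨i, hi, hn⟩
    simp [hi, h i hi] at hn

end OracleComputable

end Oracle

/-! ### Computable relations between points of Baire space -/

/-- A single algorithm computes every value of `F` from the argument. -/
def RelComputable (F : Baire → Set Baire) : Prop :=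
  ∃ φ : List ℕ → ℕ → Option ℕ, Computable₂ φ ∧ PrefixMono φ ∧
    ∀ p, ∀ q ∈ F p, ∀ n, ∃ k, φ (p.initSeg k) n = some (q n)

/-- Composition of relations. -/
def relComp (C F : Baire → Set Baire) : Baire → Set Baire := fun p => {z | ∃ y ∈ F p, z ∈ C y}

/-- The pairs of values of two relations. -/
def relJoin (F G : Baire → Set Baire) : Baire → Set Baire :=
  fun p => {r | ∃ y ∈ F p, ∃ z ∈ G p, r = Baire.join y z}

@[simp] theorem Baire.join_even (p q : Baire) (n : ℕ) : Baire.join p q (2 * n) = p n := by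
  simp [Baire.join]

@[simp] theorem Baire.join_odd (p q : Baire) (n : ℕ) : Baire.join p q (2 * n + 1) = q n := by
  have h₁ : (2 * n + 1) % 2 = 1 := by omega
  have h₂ : (2 * n + 1) / 2 = n := by omega
  simp [Baire.join, h₁, h₂]

theorem PrefixMono.eq_of {α β : Type*} {φ : List ℕ → α → Option β} (h : PrefixMono φ) {p : Baire}
    {k l : ℕ} {a : α} {b c : β} (hb : φ (p.initSeg k) a = some b)
    (hc : φ (p.initSeg l) a = some c) : b = c := by
  have h₁ := h (p.initSeg_prefix (le_max_left k l)) hb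
  have h₂ := h (p.initSeg_prefix (le_max_right k l)) hc
  exact Option.some.inj (h₁.symm.trans h₂)

namespace RelComputable

theorem mono {F G : Baire → Set Baire} (hF : RelComputable F) (h : ∀ p, G p ⊆ F p) :
    RelComputable G := by
  obtain ⟨φ, hφ, mφ, cφ⟩ := hF
  exact ⟨φ, hφ, mφ, fun p q hq => cφ p q (h p hq)⟩

theorem of_oracle {g : Baire → Baire} (hg : OracleComputable g) : RelComputable fun p => {g p} := by
  obtain ⟨φ, hφ, mφ, cφ⟩ := hg
  refine ⟨φ, hφ, mφ, ?_⟩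
  rintro p q rfl n
  exact cφ p n

protected theorem id : RelComputable fun p => {p} :=
  of_oracle (g := fun p => p) (OracleComputable.query OracleComputable.id)

/-- Answers that persist on longer prefixes cannot conflict, so a computable relation is a partial
function. -/
theorem unique {F : Baire → Set Baire} (hF : RelComputable F) {p q r : Baire} (hq : q ∈ F p)
    (hr : r ∈ F p) : q = r := by
  obtain ⟨φ, -, mφ, cφ⟩ := hF
  funext n
  obtain ⟨k, hk⟩ := cφ p q hq n
  obtain ⟨l, hl⟩ := cφ p r hr n
  exact mφ.eq_of hk hl

theorem join {F G : Baire → Set Baire} (hF : RelComputable F) (hG : RelComputable G) :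
    RelComputable (relJoin F G) := by
  obtain ⟨φ, hφ, mφ, cφ⟩ := hF
  obtain ⟨ψ, hψ, mψ, cψ⟩ := hG
  refine ⟨fun w n => bif decide (n % 2 = 0) then φ w (n / 2) else ψ w (n / 2), ?_, ?_, ?_⟩
  · have h2 : Computable fun x : List ℕ × ℕ => x.2 / 2 :=
      (Primrec.nat_div.comp Primrec.snd (Primrec.const 2)).to_comp
    exact Computable.cond (Primrec.eq.comp (Primrec.nat_mod.comp Primrec.snd (Primrec.const 2))
      (Primrec.const 0)).decide.to_comp (hφ.comp Computable.fst h2) (hψ.comp Computable.fst h2)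
  · intro w w' n b hw h
    by_cases hn : n % 2 = 0
    · simp only [hn, decide_true, cond_true] at h ⊢
      exact mφ hw h
    · simp only [hn, decide_false, cond_false] at h ⊢
      exact mψ hw h
  · rintro p _ ⟨y, hy, z, hz, rfl⟩ n
    by_cases hn : n % 2 = 0
    · simpa [hn, Baire.join] using cφ p y hy (n / 2)
    · simpa [hn, Baire.join] using cψ p z hz (n / 2)

/-- The values that are available from `w`, listed up to the first missing one. -/
def outputs (φ : List ℕ → ℕ → Option ℕ) (w : List ℕ) : List ℕ :=
  (List.range (boundedFind (fun i => (φ w i).isNone) w.length)).map fun i => (φ w i).getD 0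

theorem outputs_computable {φ : List ℕ → ℕ → Option ℕ} (hφ : Computable₂ φ) :
    Computable (outputs φ) := by
  have h : OracleComputable fun _ (x : List ℕ × ℕ) => φ x.1 x.2 :=
    OracleComputable.of_computable hφ
  have hn : OracleComputable fun _ (x : List ℕ × ℕ) => (φ x.1 x.2).isNone :=
    (OracleComputable.map Primrec.not (OracleComputable.map Primrec.option_isSome h)).of_eq
      fun p x => by cases φ x.1 x.2 <;> rfl
  exact (OracleComputable.map_range (h.getD (.const 0))
    (.boundedFind hn (.map Primrec.list_length .id))).computable

theorem exists_eq_some_of_lt_outputs {φ : List ℕ → ℕ → Option ℕ} {w : List ℕ} {i : ℕ}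
    (h : i < boundedFind (fun i => (φ w i).isNone) w.length) : ∃ b, φ w i = some b := by
  have := boundedFind_min h
  cases hb : φ w i with
  | none => simp [hb] at this
  | some b => exact ⟨b, rfl⟩

/-- An answer once available stays available, so the first missing position can only move to the
right. -/
theorem outputs_prefix {φ : List ℕ → ℕ → Option ℕ} (mφ : PrefixMono φ) {w w' : List ℕ}
    (h : w <+: w') : outputs φ w <+: outputs φ w' := by
  have hJ : boundedFind (fun i => (φ w i).isNone) w.length ≤
      boundedFind (fun i => (φ w' i).isNone) w'.length := by
    by_contra hlt
    rw [not_le] at hlt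
    obtain ⟨b, hb⟩ := exists_eq_some_of_lt_outputs hlt
    have h₁ := boundedFind_spec (hlt.trans_le ((boundedFind_le _ _).trans h.length_le))
    rw [mφ h hb] at h₁
    cases h₁
  obtain ⟨d, hd⟩ := Nat.exists_eq_add_of_le hJ
  unfold outputs
  rw [hd, List.range_add, List.map_append]
  have hmap : (List.range (boundedFind (fun i => (φ w i).isNone) w.length)).map
      (fun i => (φ w i).getD 0) = (List.range (boundedFind (fun i => (φ w i).isNone)
        w.length)).map fun i => (φ w' i).getD 0 := List.map_congr_left fun i hi => ?_
  · rw [hmap]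
    exact List.prefix_append _ _
  obtain ⟨b, hb⟩ := exists_eq_some_of_lt_outputs (List.mem_range.1 hi)
  rw [hb, mφ h hb]

theorem exists_prefix_outputs {φ : List ℕ → ℕ → Option ℕ} (mφ : PrefixMono φ) {p q : Baire}
    (h : ∀ n, ∃ k, φ (p.initSeg k) n = some (q n)) (k : ℕ) :
    ∃ l, q.initSeg k <+: outputs φ (p.initSeg l) := by
  have hl : ∀ j, ∃ l, ∀ i, i < j → φ (p.initSeg l) i = some (q i) := by
    intro j
    induction j with
    | zero => exact ⟨0, by simp⟩
    | succ j ih =>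
      obtain ⟨l, hl⟩ := ih
      obtain ⟨l', hl'⟩ := h j
      refine ⟨max l l', fun i hi => ?_⟩
      rcases Nat.lt_succ_iff_lt_or_eq.1 hi with hi | rfl
      · exact mφ (p.initSeg_prefix (le_max_left _ _)) (hl i hi)
      · exact mφ (p.initSeg_prefix (le_max_right _ _)) hl'
  obtain ⟨l, hl⟩ := hl k
  -- The length must reach `k` as well, because `outputs` lists at most as many values as its input
  -- is long.
  refine ⟨max k l, ?_⟩
  have hs : ∀ i, i < k → φ (p.initSeg (max k l)) i = some (q i) := fun i hi =>
    mφ (p.initSeg_prefix (le_max_right _ _)) (hl i hi)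
  have hJ : k ≤ boundedFind (fun i => (φ (p.initSeg (max k l)) i).isNone)
      (p.initSeg (max k l)).length := by
    by_contra hlt
    rw [not_le] at hlt
    have h₁ := boundedFind_spec (hlt.trans_le (by simp))
    rw [hs _ hlt] at h₁
    cases h₁
  obtain ⟨d, hd⟩ := Nat.exists_eq_add_of_le hJ
  unfold outputs
  rw [hd, List.range_add, List.map_append]
  have hmap : q.initSeg k = (List.range k).map fun i => (φ (p.initSeg (max k l)) i).getD 0 :=
    List.map_congr_left fun i hi => ?_
  · rw [hmap]
    exact List.prefix_append _ _
  rw [hs i (List.mem_range.1 hi), Option.getD_some]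

theorem comp {C F : Baire → Set Baire} (hC : RelComputable C) (hF : RelComputable F) :
    RelComputable (relComp C F) := by
  obtain ⟨φ, hφ, mφ, cφ⟩ := hF
  obtain ⟨ψ, hψ, mψ, cψ⟩ := hC
  refine ⟨fun w n => ψ (outputs φ w) n,
    hψ.comp ((outputs_computable hφ).comp Computable.fst) Computable.snd,
    fun w w' n b hw h => mψ (outputs_prefix mφ hw) h, ?_⟩
  rintro p r ⟨q, hq, hr⟩ n
  obtain ⟨k, hk⟩ := cψ q r hr n
  obtain ⟨l, hl⟩ := exists_prefix_outputs mφ (cφ p q hq) k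
  exact ⟨l, mψ hl hk⟩

theorem _root_.OracleComputable.subst {α β : Type*} [Primcodable α] [Primcodable β]
    {f : Baire → α → β} {g : Baire → Baire} (hf : OracleComputable f) (hg : OracleComputable g) :
    OracleComputable fun p a => f (g p) a := by
  obtain ⟨φ, hφ, mφ, cφ⟩ := hg
  obtain ⟨ψ, hψ, mψ, cψ⟩ := hf
  refine ⟨fun w a => ψ (outputs φ w) a,
    hψ.comp ((outputs_computable hφ).comp Computable.fst) Computable.snd,
    fun w w' n b hw h => mψ (outputs_prefix mφ hw) h, fun p a => ?_⟩
  obtain ⟨k, hk⟩ := cψ (g p) a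
  obtain ⟨l, hl⟩ := exists_prefix_outputs mφ (cφ p) k
  exact ⟨l, mψ hl hk⟩

/-- The given algorithm may fall silent again on longer prefixes, and off the domain it may even
change its answer. Taking the answer on the shortest prefix that has one makes it persistent; on the
domain this is harmless, since every answer is correct there. -/
theorem of_computableOnBaire {F : Baire →. Baire} (hF : ComputableOnBaire F) :
    RelComputable fun p => {q | q ∈ F p} := by
  obtain ⟨φ, hφ, cφ⟩ := hF
  let J : List ℕ → ℕ → ℕ := fun w n => boundedFind (fun k => (φ (w.take k) n).isSome) w.length
  have hJ : ∀ w n b, φ (w.take (J w n)) n = some b → ∀ w', w <+: w' → J w' n = J w n := by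
    rintro w n b hb w' hw
    have htake : ∀ k ≤ w.length, w'.take k = w.take k := by
      intro k hk
      obtain ⟨t, rfl⟩ := hw
      rw [List.take_append_of_le_length hk]
    have hle := boundedFind_le (fun k => (φ (w.take k) n).isSome) w.length
    have hj : ∀ j, j < J w n → (φ (w'.take j) n).isSome = false := fun j hj => by
      rw [htake j (hj.le.trans hle)]
      exact boundedFind_min hj
    have hs : (φ (w'.take (J w n)) n).isSome = true := by rw [htake _ hle, hb]; rfl
    -- If the shortest successful prefix is `w'` itself, it lies outside the range of the bounded
    -- search, whose default value is the same number.
    rcases (hle.trans hw.length_le).lt_or_eq with h | h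
    · exact boundedFind_eq_of h hs hj
    · refine le_antisymm (boundedFind_le_of hs) ?_
      by_contra hlt
      rw [not_le] at hlt
      have h₁ := boundedFind_spec (P := fun k => (φ (w'.take k) n).isSome) (hlt.trans_eq h)
      rw [hj _ hlt] at h₁
      cases h₁
  refine ⟨fun w n => φ (w.take (J w n)) n, ?_, ?_, ?_⟩
  · have h₁ : OracleComputable fun _ (x : (List ℕ × ℕ) × ℕ) =>
        (φ (x.1.1.take x.2) x.1.2).isSome := by
      refine .map Primrec.option_isSome ((OracleComputable.of_computable hφ).app₂
        (.map₂ Primrec.list_take OracleComputable.id.snd OracleComputable.id.fst.fst)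
        OracleComputable.id.fst.snd)
    have h₂ : OracleComputable fun _ (x : List ℕ × ℕ) => φ (x.1.take (J x.1 x.2)) x.2 :=
      (OracleComputable.of_computable hφ).app₂
        (.map₂ Primrec.list_take (.boundedFind h₁ (.map Primrec.list_length
          OracleComputable.id.fst)) OracleComputable.id.fst) OracleComputable.id.snd
    exact h₂.computable
  · intro w w' n b hw hb
    have hle := boundedFind_le (fun k => (φ (w.take k) n).isSome) w.length
    dsimp only at hb ⊢
    rw [hJ w n b hb w' hw]
    obtain ⟨t, rfl⟩ := hw
    rwa [List.take_append_of_le_length hle]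
  · rintro p q hq n
    obtain ⟨⟨k, hk⟩, hc⟩ := cφ p q hq n
    refine ⟨k + 1, ?_⟩
    have hlt : J (p.initSeg (k + 1)) n < (p.initSeg (k + 1)).length := by
      refine boundedFind_lt_iff.2 ⟨k, by simp, ?_⟩
      rw [p.take_initSeg k.le_succ, hk]
      rfl
    have hs := boundedFind_spec hlt
    change (φ ((p.initSeg (k + 1)).take (J (p.initSeg (k + 1)) n)) n).isSome = true at hs
    obtain ⟨b, hb⟩ := Option.isSome_iff_exists.1 hs
    dsimp only
    have hb' := hb
    rw [p.take_initSeg (hlt.le.trans (by simp))] at hb'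
    rw [hb, hc _ _ hb']

theorem computableOnBaire {F : Baire → Set Baire} (hF : RelComputable F) {G : Baire →. Baire}
    (hG : ∀ p, ∀ q ∈ G p, q ∈ F p) : ComputableOnBaire G := by
  obtain ⟨φ, hφ, mφ, cφ⟩ := hF
  refine ⟨φ, hφ, fun p q hq n => ?_⟩
  obtain ⟨k, hk⟩ := cφ p q (hG p q hq) n
  exact ⟨⟨k, hk⟩, fun l m hl => mφ.eq_of hl hk⟩

end RelComputable

/-- A partial function choosing a value of a relation wherever there is one. -/
noncomputable def relSelect (F : Baire → Set Baire) : Baire →. Baire :=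
  fun p => ⟨(F p).Nonempty, fun h => h.some⟩

theorem relSelect_mem {F : Baire → Set Baire} {p q : Baire} (h : q ∈ relSelect F p) : q ∈ F p := by
  obtain ⟨hd, rfl⟩ := h
  exact hd.some_mem

theorem mem_relSelect {F : Baire → Set Baire} {p q : Baire} (h : q ∈ F p)
    (hu : ∀ q' ∈ F p, q' = q) : q ∈ relSelect F p :=
  ⟨⟨q, h⟩, hu _ (Set.Nonempty.some_mem _)⟩

/-! ### The limit operator -/

theorem limBaire_unique {p q r : Baire} (hq : q ∈ limBaire p) (hr : r ∈ limBaire p) : q = r := by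
  funext n
  obtain ⟨i, h₁, h₂⟩ := ((hq n).and (hr n)).exists
  exact h₁.symm.trans h₂

theorem mem_limPow_zero {p q : Baire} : q ∈ limPow 0 p ↔ q = p := Iff.rfl

/-- The domain condition in `MultiFun.comp` is automatic because limits are unique. -/
theorem mem_limPow_succ {n : ℕ} {p q : Baire} :
    q ∈ limPow (n + 1) p ↔ ∃ y ∈ limBaire p, q ∈ limPow n y := by
  constructor
  · rintro ⟨-, y, hy, hq⟩
    exact ⟨y, hy, hq⟩
  · rintro ⟨y, hy, hq⟩
    refine ⟨fun z hz => ?_, y, hy, hq⟩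
    obtain rfl := limBaire_unique hy hz
    exact ⟨q, hq⟩

/-- The definition splits off the limit applied first; inductions on `LimComputable` and on
quantifier alternations need the one applied last. -/
theorem mem_limPow_succ' {n : ℕ} {p q : Baire} :
    q ∈ limPow (n + 1) p ↔ ∃ y ∈ limPow n p, q ∈ limBaire y := by
  induction n generalizing p with
  | zero =>
    rw [mem_limPow_succ]
    constructor
    · rintro ⟨y, hy, rfl⟩
      exact ⟨p, rfl, hy⟩
    · rintro ⟨y, rfl, hy⟩
      exact ⟨q, hy, rfl⟩
  | succ n ih =>
    rw [mem_limPow_succ]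
    constructor
    · rintro ⟨y, hy, hq⟩
      obtain ⟨z, hz, hq⟩ := ih.1 hq
      exact ⟨z, mem_limPow_succ.2 ⟨y, hy, hz⟩, hq⟩
    · rintro ⟨z, hz, hq⟩
      obtain ⟨y, hy, hz⟩ := mem_limPow_succ.1 hz
      exact ⟨y, hy, ih.2 ⟨z, hz, hq⟩⟩

theorem limPow_unique {n : ℕ} {p q r : Baire} (hq : q ∈ limPow n p) (hr : r ∈ limPow n p) :
    q = r := by
  induction n generalizing p with
  | zero => exact (mem_limPow_zero.1 hq).trans (mem_limPow_zero.1 hr).symm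
  | succ n ih =>
    obtain ⟨y, hy, hq⟩ := mem_limPow_succ.1 hq
    obtain ⟨z, hz, hr⟩ := mem_limPow_succ.1 hr
    obtain rfl := limBaire_unique hy hz
    exact ih hq hr

theorem limPow_one : limPow 1 = limBaire := by
  funext p
  ext q
  refine mem_limPow_succ.trans ⟨?_, fun h => ⟨q, h, rfl⟩⟩
  rintro ⟨y, hy, rfl⟩
  exact hy

/-- The relations that arise from computable ones by `n` applications of the limit operator. -/
def LimComputable : ℕ → (Baire → Set Baire) → Prop
  | 0, F => RelComputable F
  | n + 1, F => ∃ F', LimComputable n F' ∧ ∀ p, ∀ q ∈ F p, ∃ r ∈ F' p, q ∈ limBaire r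

/-- Computing `C` after a limit from the approximations instead. -/
theorem exists_lim_comm {C : Baire → Set Baire} (hC : RelComputable C) :
    ∃ g : Baire → Baire, OracleComputable g ∧
      ∀ p, ∀ q ∈ limBaire p, ∀ r ∈ C q, r ∈ limBaire (g p) := by
  obtain ⟨φ, hφ, mφ, cφ⟩ := hC
  -- `L p s k` is the guess at stage `s` for the first `k` values of the limit; `J p m s` is the
  -- length of the shortest guess, below `s`, on which the algorithm answers at `m`.
  let L : Baire → ℕ → ℕ → List ℕ := fun p s k => (List.range k).map fun i => p (Nat.pair i s)
  let J : Baire → ℕ → ℕ → ℕ := fun p m s => boundedFind (fun k => (φ (L p s k) m).isSome) s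
  refine ⟨fun p j => (φ (L p j.unpair.2 (J p j.unpair.1 j.unpair.2)) j.unpair.1).getD 0,
    ?_, ?_⟩
  · have hid : OracleComputable fun _ (x : (ℕ × ℕ) × ℕ) => x := .id
    have hL : OracleComputable fun p (x : (ℕ × ℕ) × ℕ) => L p x.1.2 x.2 :=
      .map_range (P := fun p (y : ((ℕ × ℕ) × ℕ) × ℕ) => p (Nat.pair y.2 y.1.1.2))
        (.query (.natPair OracleComputable.id.snd OracleComputable.id.fst.fst.snd)) hid.snd
    have hJ : OracleComputable fun p (x : ℕ × ℕ) => J p x.1 x.2 :=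
      .boundedFind (P := fun p (x : (ℕ × ℕ) × ℕ) => (φ (L p x.1.2 x.2) x.1.1).isSome)
        (.map Primrec.option_isSome ((OracleComputable.of_computable hφ).app₂ hL hid.fst.fst))
        OracleComputable.id.snd
    have hG : OracleComputable fun p (x : ℕ × ℕ) => (φ (L p x.2 (J p x.1 x.2)) x.1).getD 0 :=
      .getD ((OracleComputable.of_computable hφ).app₂ (hL.app₂ .id hJ) OracleComputable.id.fst)
        (.const 0)
    exact hG.comp (.map Primrec.unpair .id)
  · intro p q hq r hr m
    obtain ⟨k, hk⟩ := cφ q r hr m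
    have hev : ∀ j, ∀ᶠ s in atTop, ∀ i, i < j → p (Nat.pair i s) = q i := by
      intro j
      exact (Set.finite_lt_nat j).eventually_all.2 fun i _ => hq i
    -- From now on the guesses up to length `k` are correct. The shortest one with an answer has
    -- length at most `k`, so its answer is the true one.
    filter_upwards [hev k, eventually_gt_atTop k] with s hs hks
    have hL : ∀ j ≤ k, L p s j = q.initSeg j := fun j hj =>
      List.map_congr_left fun i hi => hs i ((List.mem_range.1 hi).trans_le hj)
    have hJk : J p m s ≤ k := boundedFind_le_of (by rw [hL k le_rfl, hk]; rfl)
    have hsome := boundedFind_spec (P := fun k => (φ (L p s k) m).isSome) (hJk.trans_lt hks)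
    obtain ⟨b, hb⟩ := Option.isSome_iff_exists.1 hsome
    change φ (L p s (J p m s)) m = some b at hb
    have hb' := hb
    rw [hL _ hJk] at hb'
    simp only [Baire.sec, Nat.unpair_pair, hb, Option.getD_some]
    exact mφ.eq_of hb' hk

namespace LimComputable

theorem mono {n : ℕ} {F G : Baire → Set Baire} (hF : LimComputable n F) (h : ∀ p, G p ⊆ F p) :
    LimComputable n G := by
  cases n with
  | zero => exact RelComputable.mono hF h
  | succ n =>
    obtain ⟨F', hF', hl⟩ := hF
    exact ⟨F', hF', fun p q hq => hl p q (h p hq)⟩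

/-- By `exists_lim_comm` the computable step moves past one limit at a time until it meets the
computable relation at the start. -/
theorem comp_rel {n : ℕ} {C F : Baire → Set Baire} (hC : RelComputable C)
    (hF : LimComputable n F) : LimComputable n (relComp C F) := by
  induction n generalizing C F with
  | zero => exact RelComputable.comp hC hF
  | succ n ih =>
    obtain ⟨F', hF', hl⟩ := hF
    obtain ⟨g, hg, hgl⟩ := exists_lim_comm hC
    refine ⟨_, ih (RelComputable.of_oracle hg) hF', ?_⟩
    rintro p z ⟨y, hy, hz⟩
    obtain ⟨r, hr, hyr⟩ := hl p y hy
    exact ⟨g r, ⟨r, hr, rfl⟩, hgl r y hyr z hz⟩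

/-- Every point is the limit of a constant sequence. -/
theorem succ {n : ℕ} {F : Baire → Set Baire} (hF : LimComputable n F) :
    LimComputable (n + 1) F := by
  have : OracleComputable fun p (j : ℕ) => p j.unpair.1 :=
    .query (.of_primrec (Primrec.fst.comp Primrec.unpair))
  refine ⟨_, comp_rel (RelComputable.of_oracle this) hF, fun p q hq => ?_⟩
  refine ⟨_, ⟨q, hq, rfl⟩, fun m => Eventually.of_forall fun s => ?_⟩
  simp [Baire.sec]

/-- Two limits become one by interleaving the rows of the two approximating tables. -/
theorem join {n : ℕ} {F G : Baire → Set Baire} (hF : LimComputable n F)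
    (hG : LimComputable n G) : LimComputable n (relJoin F G) := by
  induction n generalizing F G with
  | zero => exact RelComputable.join hF hG
  | succ n ih =>
    obtain ⟨F', hF', hlF⟩ := hF
    obtain ⟨G', hG', hlG⟩ := hG
    have h : OracleComputable fun p (j : ℕ) =>
        if j.unpair.1 % 2 = 0 then p (2 * Nat.pair (j.unpair.1 / 2) j.unpair.2)
        else p (2 * Nat.pair (j.unpair.1 / 2) j.unpair.2 + 1) := by
      have h₁ : Primrec fun j : ℕ => j.unpair.1 := Primrec.fst.comp Primrec.unpair
      have h₂ : Primrec fun j : ℕ => 2 * Nat.pair (j.unpair.1 / 2) j.unpair.2 :=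
        Primrec.nat_double.comp (Primrec₂.natPair.comp (Primrec.nat_div.comp h₁ (Primrec.const 2))
          (Primrec.snd.comp Primrec.unpair))
      refine .ite (.of_primrec (Primrec.eq.comp (Primrec.nat_mod.comp h₁ (Primrec.const 2))
        (Primrec.const 0)).decide) (.query (.of_primrec h₂))
        (.query (.of_primrec (Primrec.succ.comp h₂)))
    refine ⟨_, comp_rel (RelComputable.of_oracle h) (ih hF' hG'), ?_⟩
    rintro p _ ⟨y, hy, z, hz, rfl⟩
    obtain ⟨r, hr, hyr⟩ := hlF p y hy
    obtain ⟨t, ht, hzt⟩ := hlG p z hz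
    refine ⟨_, ⟨_, ⟨r, hr, t, ht, rfl⟩, rfl⟩, fun m => ?_⟩
    simp only [Baire.sec, Nat.unpair_pair, Baire.join_even, Baire.join_odd]
    by_cases hm : m % 2 = 0
    · simpa [hm, Baire.join, Baire.sec] using hyr (m / 2)
    · simpa [hm, Baire.join, Baire.sec] using hzt (m / 2)

theorem of_rel {n : ℕ} {F : Baire → Set Baire} (hF : RelComputable F) : LimComputable n F := by
  induction n with
  | zero => exact hF
  | succ n ih => exact ih.succ

theorem comp {n m : ℕ} {C F : Baire → Set Baire} (hC : LimComputable n C)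
    (hF : LimComputable m F) : LimComputable (m + n) (relComp C F) := by
  induction n generalizing C with
  | zero => exact comp_rel hC hF
  | succ n ih =>
    obtain ⟨C', hC', hl⟩ := hC
    refine ⟨_, ih hC', ?_⟩
    rintro p z ⟨y, hy, hz⟩
    obtain ⟨r, hr, hzr⟩ := hl y z hz
    exact ⟨r, ⟨y, hy, hr⟩, hzr⟩

theorem limPow (n : ℕ) : LimComputable n (_root_.limPow n) := by
  induction n with
  | zero => exact RelComputable.id
  | succ n ih => exact ⟨_, ih, fun p q hq => mem_limPow_succ'.1 hq⟩

theorem exists_limPow {n : ℕ} {F : Baire → Set Baire} (hF : LimComputable n F) :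
    ∃ H, RelComputable H ∧ ∀ p, ∀ q ∈ F p, ∃ r ∈ H p, q ∈ _root_.limPow n r := by
  induction n generalizing F with
  | zero => exact ⟨F, hF, fun p q hq => ⟨q, hq, rfl⟩⟩
  | succ n ih =>
    obtain ⟨F', hF', hl⟩ := hF
    obtain ⟨H, hH, h⟩ := ih hF'
    refine ⟨H, hH, fun p q hq => ?_⟩
    obtain ⟨y, hy, hqy⟩ := hl p q hq
    obtain ⟨r, hr, hyr⟩ := h p y hy
    exact ⟨r, hr, mem_limPow_succ'.2 ⟨y, hyr, hqy⟩⟩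

end LimComputable

/-! ### Weihrauch reducibility to the powers of the limit operator -/

namespace MultiFun

variable {X Y Z W : RepresentedSpace}

/-- Every name of a point of the domain of `f` is related by `F` to a name of a value. -/
def IsRelRealizer (F : Baire → Set Baire) (f : MultiFun X Y) : Prop :=
  ∀ p x, X.Names p x → x ∈ f.dom → ∃ q ∈ F p, ∃ y ∈ f x, Y.Names q y

theorem odds_computable : RelComputable fun p => {q | q = fun n => p (2 * n + 1)} :=
  RelComputable.of_oracle (.query (.of_primrec Primrec.nat_double_succ))

theorem odds_computableOnBaire :
    ComputableOnBaire fun p => Part.some fun n => p (2 * n + 1) :=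
  odds_computable.computableOnBaire fun _ _ h => Part.mem_some_iff.1 h

theorem weihrauchLE_refl (f : MultiFun X Y) : WeihrauchLE f f := by
  refine ⟨fun p => Part.some fun n => p (2 * n + 1), fun p => Part.some p, odds_computableOnBaire,
    RelComputable.id.computableOnBaire fun _ _ h => Part.mem_some_iff.1 h, fun G hG p x hp hx => ?_⟩
  obtain ⟨q, hq, y, hy, hn⟩ := hG p x hp hx
  refine ⟨q, ?_, y, hy, hn⟩
  refine Part.mem_bind_iff.2 ⟨p, Part.mem_some _, Part.mem_bind_iff.2 ⟨q, hq, ?_⟩⟩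
  rw [Part.mem_some_iff]
  funext n
  simp

theorem weihrauchEquiv_refl (f : MultiFun X Y) : WeihrauchEquiv f f :=
  ⟨weihrauchLE_refl f, weihrauchLE_refl f⟩

/-- All post-processing is already absorbed into the stages before the limits, so the outer function
of the reduction only discards the original input. -/
theorem weihrauchLE_limPow {n : ℕ} {f : MultiFun X Y} {F : Baire → Set Baire}
    (hF : LimComputable n F) (h : IsRelRealizer F f) : WeihrauchLE f (limPow n) := by
  obtain ⟨H, hH, hl⟩ := hF.exists_limPow
  refine ⟨fun p => Part.some fun n => p (2 * n + 1), relSelect H, odds_computableOnBaire,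
    hH.computableOnBaire fun _ _ h => relSelect_mem h, fun G hG p x hp hx => ?_⟩
  obtain ⟨q, hq, y, hy, hn⟩ := h p x hp hx
  obtain ⟨r, hr, hqr⟩ := hl p q hq
  obtain ⟨_, hs, z, hz, rfl⟩ := hG r r rfl ⟨q, hqr⟩
  obtain rfl := limPow_unique hqr hz
  refine ⟨q, ?_, y, hy, hn⟩
  refine Part.mem_bind_iff.2 ⟨r, mem_relSelect hr fun q' hq' => hH.unique hq' hr,
    Part.mem_bind_iff.2 ⟨q, hs, ?_⟩⟩
  rw [Part.mem_some_iff]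
  funext n
  simp

/-- The reduction is run on the canonical realizer of `limPow n`. The input, which the outer
function needs again, is carried through the limits as a constant sequence. -/
theorem WeihrauchLE.exists_isRelRealizer {n : ℕ} {f : MultiFun X Y}
    (h : WeihrauchLE f (limPow n)) : ∃ F, LimComputable n F ∧ IsRelRealizer F f := by
  obtain ⟨K, H, hK, hH, hKH⟩ := h
  have hL : LimComputable n (relComp (limPow n) fun p => {q | q ∈ H p}) := by
    simpa using LimComputable.comp (LimComputable.limPow n) (m := 0)
      (RelComputable.of_computableOnBaire hH)
  refine ⟨_, LimComputable.comp_rel (RelComputable.of_computableOnBaire hK)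
    (LimComputable.join (LimComputable.of_rel RelComputable.id) hL), ?_⟩
  have hG : IsRealizer (relSelect (limPow n)) (limPow n) := by
    rintro p _ rfl ⟨q, hq⟩
    exact ⟨q, mem_relSelect hq fun q' hq' => limPow_unique hq' hq, q, hq, rfl⟩
  intro p x hp hx
  obtain ⟨q, hq, y, hy, hn⟩ := hKH _ hG p x hp hx
  obtain ⟨r, hr, hq⟩ := Part.mem_bind_iff.1 hq
  obtain ⟨s, hs, hq⟩ := Part.mem_bind_iff.1 hq
  exact ⟨q, ⟨_, ⟨p, rfl, s, ⟨r, hr, relSelect_mem hs⟩, rfl⟩, hq⟩, y, hy, hn⟩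

/-- For maximality, realizers of the two factors use `1` and `n` limits, and composing them uses `1
+ n`. -/
theorem isStar_limPow (n : ℕ) : IsStar (limPow n) limBaire (limPow (n + 1)) := by
  refine ⟨⟨_, _, _, limPow n, limBaire, weihrauchEquiv_refl _, weihrauchEquiv_refl _,
    weihrauchEquiv_refl _⟩, fun P Q R f₀ g₀ hf hg => ?_⟩
  rw [← limPow_one] at hg
  obtain ⟨F, hF, rF⟩ := hf.1.exists_isRelRealizer
  obtain ⟨G, hG, rG⟩ := hg.1.exists_isRelRealizer
  rw [add_comm n 1]
  refine weihrauchLE_limPow (hF.comp hG) ?_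
  rintro p x hp ⟨z, hsub, y, hy, hz⟩
  obtain ⟨q, hq, y', hy', hqn⟩ := rG p x hp ⟨y, hy⟩
  obtain ⟨r, hr, z', hz', hrn⟩ := rF q y' hqn (hsub hy')
  exact ⟨r, ⟨q, hq, hr⟩, z', ⟨hsub, y', hy', hz'⟩, hrn⟩

end MultiFun

theorem isStarPower_limPow (n : ℕ) : IsStarPower limBaire n (limPow n) := by
  induction n with
  | zero => exact MultiFun.weihrauchEquiv_refl _
  | succ n ih => exact ⟨_, _, _, ih, MultiFun.isStar_limPow n⟩

/-! ### Plays and their finite prefixes -/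

/-- The first `k` moves of the play `x`. -/
def prefixOf (x : Cantor) (k : ℕ) : List Bool := (List.range k).map x

@[simp] theorem length_prefixOf (x : Cantor) (k : ℕ) : (prefixOf x k).length = k := by
  simp [prefixOf]

theorem prefixOf_succ (x : Cantor) (k : ℕ) : prefixOf x (k + 1) = prefixOf x k ++ [x k] := by
  simp [prefixOf, List.range_succ]

theorem take_prefixOf (x : Cantor) {i k : ℕ} (h : i ≤ k) :
    (prefixOf x k).take i = prefixOf x i := by
  simp [prefixOf, ← List.map_take, List.take_range, h]

theorem mem_cylinder_iff {w : List Bool} {x : Cantor} :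
    x ∈ cylinder w ↔ prefixOf x w.length = w := by
  constructor
  · intro h
    refine List.ext_getElem (by simp) fun i h₁ h₂ => ?_
    simpa [prefixOf] using h i h₂
  · intro h i hi
    conv_rhs => rw [← List.getElem_of_eq h (by simpa using hi)]
    simp [prefixOf]

namespace Game

@[simp] theorem length_historyFrom (s : List Bool → Bool) (w : List Bool) (n : ℕ) :
    (historyFrom s w n).length = w.length + n := by
  induction n with
  | zero => rfl
  | succ n ih => simp [historyFrom, ih, add_assoc]

theorem historyFrom_prefix (s : List Bool → Bool) (w : List Bool) (n d : ℕ) :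
    historyFrom s w n <+: historyFrom s w (n + d) := by
  induction d with
  | zero => exact List.prefix_rfl
  | succ d ih => exact ih.trans (List.prefix_append _ _)

theorem prefixOf_play (s : List Bool → Bool) (w : List Bool) (n : ℕ) :
    prefixOf (play s w) (w.length + n) = historyFrom s w n := by
  refine List.ext_getElem (by simp) fun i h₁ h₂ => ?_
  simp only [prefixOf, List.getElem_map, List.getElem_range, play]
  have hi : i < (historyFrom s w (i + 1)).length := by simp; omega
  rw [List.getD_eq_getElem _ _ hi]
  rcases le_total n (i + 1) with h | h
  · obtain ⟨d, hd⟩ := Nat.exists_eq_add_of_le h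
    rw [(hd ▸ historyFrom_prefix s w n d : historyFrom s w n <+: historyFrom s w (i + 1)).getElem]
  · obtain ⟨d, hd⟩ := Nat.exists_eq_add_of_le h
    rw [(hd ▸ historyFrom_prefix s w (i + 1) d :
      historyFrom s w (i + 1) <+: historyFrom s w n).getElem]

theorem prefixOf_play_length (s : List Bool → Bool) (w : List Bool) :
    prefixOf (play s w) w.length = w := prefixOf_play s w 0

theorem play_apply (s : List Bool → Bool) (w : List Bool) {k : ℕ} (h : w.length ≤ k) :
    play s w k = s (prefixOf (play s w) k) := by
  obtain ⟨d, rfl⟩ := Nat.exists_eq_add_of_le h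
  have h₁ := prefixOf_succ (play s w) (w.length + d)
  rw [add_assoc, prefixOf_play, prefixOf_play, historyFrom] at h₁
  rw [prefixOf_play]
  simpa using h₁.symm

end Game

open Classical in
/-- The successor of the least number satisfying `P`, or `0` if there is none. -/
noncomputable def succLeast (P : ℕ → Prop) : ℕ := if h : ∃ j, P j then Nat.find h + 1 else 0

/-! ### Games with two outcomes and finitely many levels -/

section Levels

variable (lev : List Bool → ℕ) (fav : ℕ → Bool) (turn : List Bool → Bool)

/-- The winner from `u` of the game in which the play is won by the player `fav l` if `l` is its
final level, when `c u` tells whether the other player has a certificate. -/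
def levelWinner (c : List Bool → ℕ) (u : List Bool) : Bool :=
  if c u = 0 then fav (lev u) else !fav (lev u)

/-- The condition on a member `u` of a finite set `F` certifying that the opponent of `fav l` can
force the play from level `l` to a lower level where he wins. -/
def CertStep (c : List Bool → ℕ) (l : ℕ) (F : List (List Bool)) (u : List Bool) : Prop :=
  (lev u < l ∧ levelWinner lev fav c u = !fav l) ∨
    (lev u = l ∧ ((u ++ [false] ∈ F ∧ u ++ [true] ∈ F) ∨
      (turn u = !fav l ∧ (u ++ [false] ∈ F ∨ u ++ [true] ∈ F))))

/-- The finite set of words with a given code. -/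
def wordsOfCode (j : ℕ) : List (List Bool) := (Encodable.decode j).getD []

/-- `j` is the code of a certificate containing `w`. -/
def IsCertCode (c : List Bool → ℕ) (w : List Bool) (j : ℕ) : Prop :=
  w ∈ wordsOfCode j ∧ ∀ u ∈ wordsOfCode j, CertStep lev fav turn c (lev w) (wordsOfCode j) u

/-- The least certificate containing `w`, increased by one, or `0` if there is none. -/
noncomputable def leastCert (c : List Bool → ℕ) (w : List Bool) : ℕ :=
  succLeast (IsCertCode lev fav turn c w)

/-- The strategy for both players given by the least certificates. -/
def levelStrategy (c : List Bool → ℕ) (w : List Bool) : Bool :=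
  if turn w = fav (lev w) then decide (levelWinner lev fav c (w ++ [true]) = turn w)
  else decide (w ++ [true] ∈ wordsOfCode (c w - 1))

variable {lev fav turn}

theorem levelWinner_congr {c c' : List Bool → ℕ} {u : List Bool} (h : c u = c' u) :
    levelWinner lev fav c u = levelWinner lev fav c' u := by simp [levelWinner, h]

/-- A certificate consults the verdicts of words of strictly lower level only. -/
theorem leastCert_congr {c c' : List Bool → ℕ} {w : List Bool}
    (h : ∀ u, lev u < lev w → c u = c' u) :
    leastCert lev fav turn c w = leastCert lev fav turn c' w := by
  have hstep : ∀ F u, CertStep lev fav turn c (lev w) F u ↔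
      CertStep lev fav turn c' (lev w) F u := by
    intro F u
    unfold CertStep
    refine or_congr_left (and_congr_right fun hu => ?_)
    rw [levelWinner_congr (h u hu)]
  have hcode : IsCertCode lev fav turn c w = IsCertCode lev fav turn c' w := by
    funext j
    simp only [IsCertCode, hstep]
  rw [leastCert, hcode, leastCert]

/-- Iterating `leastCert` settles the words of one more level in each step. -/
theorem iterate_leastCert_succ (k : ℕ) : ∀ w, lev w ≤ k →
    (leastCert lev fav turn)^[k + 1] (fun _ => 0) w =
      (leastCert lev fav turn)^[k] (fun _ => 0) w := by
  induction k with
  | zero =>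
    intro w hw
    have hw0 : lev w = 0 := by omega
    simp only [Function.iterate_succ, Function.iterate_zero, Function.comp_apply, id_eq]
    rw [leastCert, succLeast, dif_neg]
    rintro ⟨j, hj, hc⟩
    -- At level `0` a certificate has no exit to a lower level, so each member needs a longer
    -- member. A longest member refutes this.
    obtain ⟨u, hu, hmax⟩ := (wordsOfCode j).toFinset.exists_max_image List.length
      ⟨w, by simpa using hj⟩
    simp only [List.mem_toFinset] at hu hmax
    have hlong : ∀ b, u ++ [b] ∉ wordsOfCode j := fun b hb => by
      have := hmax _ hb
      simp at this
    rcases hc u hu with ⟨h, -⟩ | ⟨-, ⟨h, -⟩ | ⟨-, h | h⟩⟩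
    · omega
    · exact hlong _ h
    · exact hlong _ h
    · exact hlong _ h
  | succ k ih =>
    intro w hw
    rw [Function.iterate_succ_apply', Function.iterate_succ_apply' (n := k)]
    refine leastCert_congr fun u hu => ?_
    have h := ih u (by omega)
    rwa [Function.iterate_succ_apply'] at h

variable {c : List Bool → ℕ}

/-- A certificate serves each of its members of the same level, so the least code for such a member
is no larger. This is why the codes never grow along a play. -/
theorem IsCertCode.winner (hc : ∀ w, leastCert lev fav turn c w = c w) {w v : List Bool} {j : ℕ}
    (h : IsCertCode lev fav turn c w j) (hv : v ∈ wordsOfCode j) (hlev : lev v ≤ lev w) :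
    levelWinner lev fav c v = !fav (lev w) ∧ (lev v = lev w → c v ≤ j + 1) := by
  rcases hlev.lt_or_eq with hlt | heq
  · refine ⟨?_, fun h' => absurd h' hlt.ne⟩
    rcases h.2 v hv with ⟨-, h'⟩ | ⟨h', -⟩
    · exact h'
    · exact absurd h' hlt.ne
  · have hvj : IsCertCode lev fav turn c v j := ⟨hv, heq ▸ h.2⟩
    classical
    have hex : ∃ j, IsCertCode lev fav turn c v j := ⟨j, hvj⟩
    have hcv := hc v
    rw [leastCert, succLeast, dif_pos hex] at hcv
    refine ⟨?_, fun _ => ?_⟩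
    · rw [levelWinner, if_neg (by omega), heq]
    · rw [← hcv]
      exact Nat.succ_le_succ (Nat.find_min' hex hvj)

theorem isCertCode_of_ne_zero (hc : ∀ w, leastCert lev fav turn c w = c w) {w : List Bool}
    (h : c w ≠ 0) : IsCertCode lev fav turn c w (c w - 1) := by
  classical
  have hcw := hc w
  by_cases hex : ∃ j, IsCertCode lev fav turn c w j
  · rw [leastCert, succLeast, dif_pos hex] at hcw
    rw [← hcw]
    exact Nat.find_spec hex
  · rw [leastCert, succLeast, dif_neg hex] at hcw
    exact absurd hcw.symm h

theorem certStep_mono {l : ℕ} {F F' : List (List Bool)} {u : List Bool} (hF : F ⊆ F')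
    (h : CertStep lev fav turn c l F u) : CertStep lev fav turn c l F' u := by
  rcases h with h | ⟨h, ⟨h₁, h₂⟩ | ⟨h₁, h₂⟩⟩
  · exact Or.inl h
  · exact Or.inr ⟨h, Or.inl ⟨hF h₁, hF h₂⟩⟩
  · exact Or.inr ⟨h, Or.inr ⟨h₁, h₂.imp (fun h => hF h) fun h => hF h⟩⟩

/-- Puts verdicts on words of level at most `l` into one format, so that certificates of children
can be merged into one for the parent. -/
theorem exists_cert_of_winner (hc : ∀ w, leastCert lev fav turn c w = c w) {v : List Bool} {l : ℕ}
    (hlev : lev v ≤ l) (h : levelWinner lev fav c v = !fav l) :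
    ∃ F, v ∈ F ∧ ∀ u ∈ F, CertStep lev fav turn c l F u := by
  rcases hlev.lt_or_eq with hlt | rfl
  · refine ⟨[v], by simp, fun u hu => ?_⟩
    obtain rfl := List.mem_singleton.1 hu
    exact Or.inl ⟨hlt, h⟩
  · have hcv : c v ≠ 0 := by
      intro h0
      rw [levelWinner, if_pos h0] at h
      cases hf : fav (lev v) <;> simp [hf] at h
    obtain ⟨h₁, h₂⟩ := isCertCode_of_ne_zero hc hcv
    exact ⟨_, h₁, h₂⟩

theorem ne_zero_of_cert (hc : ∀ w, leastCert lev fav turn c w = c w) {w : List Bool}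
    {F : List (List Bool)} (hw : w ∈ F) (hF : ∀ u ∈ F, CertStep lev fav turn c (lev w) F u) :
    c w ≠ 0 := by
  classical
  have hex : ∃ j, IsCertCode lev fav turn c w j :=
    ⟨Encodable.encode F, by simpa [wordsOfCode] using hw, by simpa [wordsOfCode] using hF⟩
  rw [← hc w, leastCert, succLeast, dif_pos hex]
  exact Nat.succ_ne_zero _

variable (turn)

/-- `win` tells for every history which player can force the play into the set `A` (first player) or
out of it (second player), and following `strat` achieves this, even from any later history. -/
structure Solves (A : Set Cantor) (win strat : List Bool → Bool) : Prop where
  own : ∀ w a, win w = a → turn w = a → win (w ++ [strat w]) = a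
  other : ∀ w a b, win w = a → turn w ≠ a → win (w ++ [b]) = a
  limit : ∀ x a N, (∀ k, N ≤ k → win (prefixOf x k) = a) →
    (∀ k, N ≤ k → turn (prefixOf x k) = a → x k = strat (prefixOf x k)) → (a = false ↔ x ∈ A)

variable {turn}

theorem eq_not_of_ne {a b : Bool} (h : a ≠ b) : a = !b := by
  cases a <;> cases b <;> simp_all

/-- A player holding a certificate stays inside it until the level drops. The favoured player
preserves the absence of certificates: were all relevant children lost, their certificates would
combine into one for the parent. -/
theorem solves_levels {A : Set Cantor} (hlev : ∀ w b, lev (w ++ [b]) ≤ lev w)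
    (hc : ∀ w, leastCert lev fav turn c w = c w)
    (hA : ∀ x N l, (∀ k, N ≤ k → lev (prefixOf x k) = l) → (fav l = false ↔ x ∈ A)) :
    Solves turn A (levelWinner lev fav c) (levelStrategy lev fav turn c) := by
  have hwin : ∀ w, levelWinner lev fav c w ≠ fav (lev w) ↔ c w ≠ 0 := by
    intro w
    unfold levelWinner
    split_ifs with h <;> simp [h]
  refine ⟨?_, ?_, ?_⟩
  · rintro w a hw ht
    by_cases ha : a = fav (lev w)
    · have h0 : c w = 0 := by
        by_contra h0
        exact (hwin w).2 h0 (hw.trans ha)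
      rw [levelStrategy, if_pos (ht.trans ha)]
      by_cases h₁ : levelWinner lev fav c (w ++ [true]) = turn w
      · rw [decide_eq_true h₁, h₁, ht]
      · rw [decide_eq_false h₁]
        by_contra h₂
        obtain ⟨F, hF, hFc⟩ := exists_cert_of_winner hc (hlev w true)
          (eq_not_of_ne (ht.trans ha ▸ h₁))
        obtain ⟨F', hF', hFc'⟩ := exists_cert_of_winner hc (hlev w false)
          (eq_not_of_ne (ha ▸ h₂))
        -- Both children are lost, so their certificates together with `w` certify that `w` is lost.
        refine ne_zero_of_cert hc (F := w :: (F ++ F')) List.mem_cons_self ?_ h0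
        intro u hu
        rcases List.mem_cons.1 hu with rfl | hu
        · exact Or.inr ⟨rfl, Or.inl ⟨by simp [hF'], by simp [hF]⟩⟩
        · rcases List.mem_append.1 hu with hu | hu
          · exact certStep_mono (fun v hv => by simp [hv]) (hFc u hu)
          · exact certStep_mono (fun v hv => by simp [hv]) (hFc' u hu)
    · have h0 : c w ≠ 0 := (hwin w).1 (hw.trans_ne ha)
      rw [levelStrategy, if_neg (ht.trans_ne ha)]
      have hcert := isCertCode_of_ne_zero hc h0
      rw [eq_not_of_ne ha]
      refine (hcert.winner hc ?_ (hlev w _)).1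
      by_cases h₁ : w ++ [true] ∈ wordsOfCode (c w - 1)
      · rwa [decide_eq_true h₁]
      · rw [decide_eq_false h₁]
        rcases hcert.2 w hcert.1 with ⟨h, -⟩ | ⟨-, ⟨h, -⟩ | ⟨-, h | h⟩⟩
        · exact absurd h (lt_irrefl _)
        · exact h
        · exact h
        · exact absurd h h₁
  · rintro w a b hw ht
    by_cases ha : a = fav (lev w)
    · have h0 : c w = 0 := by
        by_contra h0
        exact (hwin w).2 h0 (hw.trans ha)
      by_contra h₂
      obtain ⟨F, hF, hFc⟩ := exists_cert_of_winner hc (hlev w b) (eq_not_of_ne (ha ▸ h₂))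
      refine ne_zero_of_cert hc (F := w :: F) List.mem_cons_self ?_ h0
      intro u hu
      rcases List.mem_cons.1 hu with rfl | hu
      · refine Or.inr ⟨rfl, Or.inr ⟨eq_not_of_ne (ha ▸ ht), ?_⟩⟩
        cases b <;> simp [hF]
      · exact certStep_mono (fun v hv => by simp [hv]) (hFc u hu)
    · have h0 : c w ≠ 0 := (hwin w).1 (hw.trans_ne ha)
      have hcert := isCertCode_of_ne_zero hc h0
      rw [eq_not_of_ne ha] at ht ⊢
      refine (hcert.winner hc ?_ (hlev w _)).1
      rcases hcert.2 w hcert.1 with ⟨h, -⟩ | ⟨-, ⟨h, h'⟩ | ⟨h, -⟩⟩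
      · exact absurd h (lt_irrefl _)
      · cases b
        · exact h
        · exact h'
      · exact absurd h ht
  · intro x a N hw hs
    have hanti : Antitone fun k => lev (prefixOf x k) :=
      antitone_nat_of_succ_le fun k => by
        rw [prefixOf_succ]
        exact hlev _ _
    obtain ⟨M₀, hM₀⟩ := WellFounded.has_min wellFounded_lt
      (Set.range fun k => lev (prefixOf x k)) ⟨_, 0, rfl⟩
    obtain ⟨⟨M, rfl⟩, hmin⟩ := hM₀
    have hconst : ∀ k, M ≤ k → lev (prefixOf x k) = lev (prefixOf x M) := fun k hk =>
      le_antisymm (hanti hk) (not_lt.1 (hmin _ ⟨k, rfl⟩))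
    rw [← hA x M _ hconst]
    set l := lev (prefixOf x M)
    suffices h : fav l = a by rw [h]
    -- Otherwise `a` holds a certificate at every late prefix of constant level. The codes do not
    -- grow, hence become constant, and infinitely many prefixes lie in one finite set.
    by_contra hne
    have hcert : ∀ k, max M N ≤ k → IsCertCode lev fav turn c (prefixOf x k)
        (c (prefixOf x k) - 1) ∧ c (prefixOf x k) ≠ 0 := by
      intro k hk
      have h0 : c (prefixOf x k) ≠ 0 := by
        refine (hwin _).1 ?_
        rw [hw k ((le_max_right _ _).trans hk), hconst k ((le_max_left _ _).trans hk)]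
        exact Ne.symm hne
      exact ⟨isCertCode_of_ne_zero hc h0, h0⟩
    have hle : ∀ k, max M N ≤ k → c (prefixOf x (k + 1)) ≤ c (prefixOf x k) := by
      intro k hk
      obtain ⟨hk₁, hk₀⟩ := hcert k hk
      have hM : M ≤ k := (le_max_left _ _).trans hk
      have hN : N ≤ k := (le_max_right _ _).trans hk
      have hmem : prefixOf x (k + 1) ∈ wordsOfCode (c (prefixOf x k) - 1) := by
        have hkl := hconst k hM
        rw [prefixOf_succ]
        by_cases ht : turn (prefixOf x k) = a
        · rw [hs k hN ht, levelStrategy, if_neg (by rw [ht, hkl]; exact Ne.symm hne)]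
          by_cases h₁ : prefixOf x k ++ [true] ∈ wordsOfCode (c (prefixOf x k) - 1)
          · rwa [decide_eq_true h₁]
          · rw [decide_eq_false h₁]
            rcases hk₁.2 _ hk₁.1 with ⟨h, -⟩ | ⟨-, ⟨h, -⟩ | ⟨-, h | h⟩⟩
            · exact absurd h (lt_irrefl _)
            · exact h
            · exact h
            · exact absurd h h₁
        · rcases hk₁.2 _ hk₁.1 with ⟨h, -⟩ | ⟨-, ⟨h, h'⟩ | ⟨h, -⟩⟩
          · exact absurd h (lt_irrefl _)
          · cases x k
            · exact h
            · exact h'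
          · rw [hkl] at h
            exact absurd (h.trans (eq_not_of_ne (Ne.symm hne)).symm) ht
      have := (hk₁.winner hc hmem (hanti k.le_succ)).2
        ((hconst _ (hM.trans k.le_succ)).trans (hconst k hM).symm)
      omega
    obtain ⟨_, ⟨K, rfl⟩, hK⟩ := WellFounded.has_min wellFounded_lt
      (Set.range fun k => c (prefixOf x (max M N + k))) ⟨_, 0, rfl⟩
    have hcc : ∀ k, c (prefixOf x (max M N + K + k)) = c (prefixOf x (max M N + K)) := by
      intro k
      refine le_antisymm ?_ (not_lt.1 (hK _ ⟨K + k, by simp [add_assoc]⟩))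
      induction k with
      | zero => exact le_rfl
      | succ k ih => exact (hle (max M N + K + k) (by omega)).trans ih
    have hmem : ∀ k, prefixOf x (max M N + K + k) ∈
        wordsOfCode (c (prefixOf x (max M N + K)) - 1) := fun k => by
      rw [← hcc k]
      exact (hcert _ (by omega)).1.1
    obtain ⟨u, hu, hmax⟩ := (wordsOfCode (c (prefixOf x (max M N + K)) - 1)).toFinset.exists_max_image
      List.length ⟨_, List.mem_toFinset.2 (hmem 0)⟩
    have := hmax _ (List.mem_toFinset.2 (hmem (u.length + 1)))
    simp only [length_prefixOf] at this
    omega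

/-- If the verdicts disagreed, the first player following `strat` against the second following
`strat'` would produce a play in `A` but outside `A'`. -/
theorem Solves.mono {A A' : Set Cantor} {win strat win' strat' : List Bool → Bool}
    (h : Solves turn A win strat) (h' : Solves turn A' win' strat') (hA : A ⊆ A') {w : List Bool}
    (hw : win w = false) : win' w = false := by
  by_contra hne
  have hw' : win' w = true := by simpa using hne
  let s : List Bool → Bool := fun u => if turn u = false then strat u else strat' u
  let x := Game.play s w
  have hx : ∀ k, w.length ≤ k → x k = s (prefixOf x k) := fun k hk => Game.play_apply s w hk
  have key : ∀ k, w.length ≤ k → win (prefixOf x k) = false ∧ win' (prefixOf x k) = true := by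
    intro k hk
    induction k, hk using Nat.le_induction with
    | base => rw [Game.prefixOf_play_length]; exact ⟨hw, hw'⟩
    | succ k hk ih =>
      rw [prefixOf_succ, hx k hk]
      by_cases ht : turn (prefixOf x k) = false
      · refine ⟨?_, h'.other _ _ _ ih.2 (by simp [ht])⟩
        rw [show s (prefixOf x k) = strat (prefixOf x k) from if_pos ht]
        exact h.own _ _ ih.1 ht
      · refine ⟨h.other _ _ _ ih.1 ht, ?_⟩
        rw [show s (prefixOf x k) = strat' (prefixOf x k) from if_neg ht]
        exact h'.own _ _ ih.2 (by simpa using ht)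
  have h₁ := (h.limit x false w.length (fun k hk => (key k hk).1) fun k hk ht => by
    rw [hx k hk]
    exact if_pos ht).1 rfl
  have h₂ := (h'.limit x true w.length (fun k hk => (key k hk).2) fun k hk ht => by
    rw [hx k hk]
    exact if_neg (by simpa using ht)).2 (hA h₁)
  cases h₂

end Levels

/-! ### Subgame-perfect equilibria from solved games with two outcomes -/

namespace Game

variable (G : Game)

/-- The outcomes at least as good for the first player as `o` (`a = false`), or better than `o`
(`a = true`). In both cases player `a` is content with `o`. -/
def cut (a : Bool) (o : Fin G.numOutcomes) : Set (Fin G.numOutcomes) :=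
  {o' | (a = false ∧ o' = o) ∨ G.pref false o o'}

theorem pref_trans {a : Bool} {o o' o'' : Fin G.numOutcomes} (h : G.pref a o o')
    (h' : G.pref a o' o'') : G.pref a o o'' :=
  have := G.pref_linear a
  _root_.trans h h'

theorem pref_irrefl (a : Bool) (o : Fin G.numOutcomes) : ¬ G.pref a o o :=
  have := G.pref_linear a
  irrefl_of (G.pref a) o

theorem pref_total (a : Bool) (o o' : Fin G.numOutcomes) :
    G.pref a o o' ∨ o = o' ∨ G.pref a o' o :=
  have := G.pref_linear a
  trichotomous_of (G.pref a) o o'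

theorem isUpper_cut (a : Bool) (o : Fin G.numOutcomes) : G.IsUpper false (G.cut a o) := by
  rintro o₁ o₂ (⟨-, rfl⟩ | h) h'
  · exact Or.inr h'
  · exact Or.inr (G.pref_trans h h')

/-- The extremal outcome is the one that `a` likes least; passing the opponent gives the one `a`
likes best. -/
theorem exists_extremal (a : Bool) {S : Set (Fin G.numOutcomes)} (hS : S.Nonempty) :
    ∃ o ∈ S, ∀ o' ∈ S, ¬ G.pref a o' o := by
  have := G.pref_linear a
  obtain ⟨o, ho, h⟩ := (Finite.wellFounded_of_trans_of_irrefl (G.pref a)).has_min S hS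
  exact ⟨o, ho, h⟩

variable {G}
variable {win strat : Bool → Fin G.numOutcomes → List Bool → Bool}

/-- Used to exclude that a player wins when no play at all is good for him. -/
theorem exists_play (turn : List Bool → Bool) {A : Set Cantor} {win strat : List Bool → Bool}
    (h : Solves turn A win strat) {w : List Bool} {a : Bool} (hw : win w = a) :
    ∃ x, (a = false ↔ x ∈ A) := by
  refine ⟨play strat w, h.limit _ a w.length (fun k hk => ?_) fun k hk _ => play_apply _ _ hk⟩
  induction k, hk using Nat.le_induction with
  | base => rwa [prefixOf_play_length]
  | succ k hk ih =>
    rw [prefixOf_succ, play_apply _ _ hk]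
    by_cases ht : turn (prefixOf (play strat w) k) = a
    · exact h.own _ _ ih ht
    · exact h.other _ _ _ ih ht

/-- The value is the lowest outcome to which the second player can hold the first. The first player
can force it: otherwise he could be held to its immediate predecessor, since exceeding the
predecessor means reaching the value. -/
theorem exists_value (h : ∀ a o, Solves G.turn (G.val ⁻¹' G.cut a o) (win a o) (strat a o))
    (w : List Bool) : ∃ o, ∀ a, win a o w = a := by
  have hne : {o | win true o w = true}.Nonempty := by
    -- The outcome the second player likes least is the first player's favourite; nothing exceeds
    -- it.
    obtain ⟨o, -, ho⟩ := G.exists_extremal true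
      (S := Set.univ) ⟨⟨0, G.outcomes_nonempty⟩, trivial⟩
    refine ⟨o, ?_⟩
    by_contra hn
    obtain ⟨x, hx⟩ := exists_play G.turn (h true o) (w := w) (a := false) (by simpa using hn)
    rcases hx.1 rfl with ⟨h', -⟩ | h'
    · cases h'
    · exact ho _ trivial ((G.antagonistic _ _).2 h')
  obtain ⟨o, ho, hmin⟩ := G.exists_extremal false hne
  refine ⟨o, fun a => ?_⟩
  cases a
  · by_contra hn
    by_cases hpred : {o' | G.pref false o' o}.Nonempty
    · obtain ⟨o', ho', hmax⟩ := G.exists_extremal true hpred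
      refine hmin o' ?_ ho'
      by_contra hn'
      refine hn ((h true o').mono (h false o) ?_ (by simpa using hn'))
      rintro x (⟨h', -⟩ | hx)
      · cases h'
      rcases G.pref_total false o (G.val x) with h' | h' | h'
      · exact Or.inr h'
      · exact Or.inl ⟨rfl, h'.symm⟩
      · exact absurd ((G.antagonistic _ _).2 hx) (hmax _ h')
    · obtain ⟨x, hx⟩ := exists_play G.turn (h false o) (w := w) (a := true) (by simpa using hn)
      have hx' : x ∉ G.val ⁻¹' G.cut false o := fun hm => by cases hx.2 hm
      rcases G.pref_total false o (G.val x) with h' | h' | h'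
      · exact hx' (Or.inr h')
      · exact hx' (Or.inl ⟨rfl, h'.symm⟩)
      · exact hpred ⟨_, h'⟩
  · exact ho

/-- Otherwise forcing at least `o` would force more than `o'`, which the second player can prevent.
-/
theorem not_pref_of_win (h : ∀ a o, Solves G.turn (G.val ⁻¹' G.cut a o) (win a o) (strat a o))
    {u : List Bool} {o o' : Fin G.numOutcomes} (ho : win false o u = false)
    (ho' : win true o' u = true) : ¬ G.pref false o' o := by
  intro hp
  have := (h false o).mono (h true o') (w := u) ?_ ho
  · rw [ho'] at this
    cases this
  · rintro x (⟨-, hx⟩ | hx)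
    · exact Or.inr (hx ▸ hp)
    · exact Or.inr (G.pref_trans hp hx)

variable {v : List Bool → Fin G.numOutcomes}

/-- A player who follows the strategies for the current value gets at least this value. -/
theorem not_pref_value (h : ∀ a o, Solves G.turn (G.val ⁻¹' G.cut a o) (win a o) (strat a o))
    (hv : ∀ w a, win a (v w) w = a) {x : Cantor} {N : ℕ} {a : Bool}
    (hx : ∀ k, N ≤ k → G.turn (prefixOf x k) = a →
      x k = strat a (v (prefixOf x k)) (prefixOf x k)) :
    ¬ G.pref a (G.val x) (v (prefixOf x N)) := by
  have hstep : ∀ k, N ≤ k → ∀ o, win a o (prefixOf x k) = a → (G.turn (prefixOf x k) = a →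
      x k = strat a o (prefixOf x k)) → win a o (prefixOf x (k + 1)) = a := by
    intro k hk o ho hs
    rw [prefixOf_succ]
    by_cases ht : G.turn (prefixOf x k) = a
    · rw [hs ht]
      exact (h a o).own _ _ ho ht
    · exact (h a o).other _ _ _ ho ht
  -- The guarantee of `a` for the old value survives the move, while his opponent has a guarantee
  -- for the new value; so the new value is no worse for `a`.
  have hmono : ∀ k, N ≤ k → ¬ G.pref a (v (prefixOf x (k + 1))) (v (prefixOf x k)) := by
    intro k hk
    have h₁ := hstep k hk _ (hv (prefixOf x k) a) (hx k hk)
    have h₂ := hv (prefixOf x (k + 1)) (!a)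
    cases a
    · exact not_pref_of_win h h₁ h₂
    · rw [G.antagonistic]
      exact not_pref_of_win h h₂ h₁
  have hmono' : ∀ k d, N ≤ k → ¬ G.pref a (v (prefixOf x (k + d))) (v (prefixOf x k)) := by
    intro k d hk
    induction d with
    | zero => exact G.pref_irrefl _ _
    | succ d ih =>
      intro hp
      rcases G.pref_total a (v (prefixOf x (k + d + 1))) (v (prefixOf x (k + d))) with h' | h' | h'
      · exact hmono _ (by omega) h'
      · exact ih (h' ▸ hp)
      · exact ih (G.pref_trans h' hp)
  -- The value that the opponent likes least among those attained is best for `a`; by monotonicity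
  -- it is kept once reached.
  obtain ⟨_, ⟨K, rfl⟩, hK⟩ := G.exists_extremal (!a)
    (S := Set.range fun d => v (prefixOf x (N + d))) ⟨_, 0, rfl⟩
  have hconst : ∀ k, N + K ≤ k → v (prefixOf x k) = v (prefixOf x (N + K)) := by
    intro k hk
    obtain ⟨d, rfl⟩ := Nat.exists_eq_add_of_le hk
    rcases G.pref_total a (v (prefixOf x (N + K + d))) (v (prefixOf x (N + K))) with h' | h' | h'
    · exact absurd h' (hmono' _ _ (by omega))
    · exact h'
    · have hm := hK _ ⟨K + d, rfl⟩
      simp only [← add_assoc] at hm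
      refine absurd ?_ hm
      cases a
      · exact (G.antagonistic _ _).2 h'
      · exact (G.antagonistic _ _).1 h'
  have hlim := (h a (v (prefixOf x (N + K)))).limit x a (N + K) (fun k hk => by
    rw [← hconst k hk]
    exact hv _ a) fun k hk ht => by
    rw [← hconst k hk]
    exact hx k (by omega) ht
  have hval : ¬ G.pref a (G.val x) (v (prefixOf x (N + K))) := by
    cases a
    · rcases hlim.1 rfl with ⟨-, h'⟩ | h'
      · rw [h']
        exact G.pref_irrefl _ _
      · exact fun h'' => G.pref_irrefl _ _ (G.pref_trans h' h'')
    · intro h'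
      have := hlim.2 (Or.inr ((G.antagonistic _ _).1 h'))
      cases this
  intro hp
  rcases G.pref_total a (v (prefixOf x (N + K))) (v (prefixOf x N)) with h' | h' | h'
  · exact hmono' N K le_rfl h'
  · exact hval (h' ▸ hp)
  · exact hval (G.pref_trans hp h')

/-- Applied to both players, `not_pref_value` pins the outcome of the equilibrium play to the value.
Applied to the opponent of a deviating player, it bounds what the deviation can gain. -/
theorem isSubgamePerfect_of_solves
    (h : ∀ a o, Solves G.turn (G.val ⁻¹' G.cut a o) (win a o) (strat a o))
    (hv : ∀ w a, win a (v w) w = a) :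
    G.IsSubgamePerfect fun w => strat (G.turn w) (v w) w := by
  intro w a s' hs' hp
  set s : List Bool → Bool := fun w => strat (G.turn w) (v w) w
  have hs : ∀ u b, G.turn u = b → s u = strat b (v u) u := by
    rintro u b rfl
    rfl
  have hself : ∀ b, ¬ G.pref b (G.val (play s w)) (v w) := by
    intro b
    have := not_pref_value h hv (x := play s w) (N := w.length) (a := b) fun k hk ht => by
      rw [play_apply s w hk, hs _ _ ht]
    rwa [prefixOf_play_length] at this
  have hdev := not_pref_value h hv (x := play s' w) (N := w.length) (a := !a) fun k hk ht => by
      rw [play_apply s' w hk, hs' _ (by rw [ht]; cases a <;> simp), hs _ _ ht]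
  rw [prefixOf_play_length] at hdev
  have heq : G.val (play s w) = v w := by
    rcases G.pref_total false (G.val (play s w)) (v w) with h' | h' | h'
    · exact absurd h' (hself false)
    · exact h'
    · exact absurd ((G.antagonistic _ _).2 h') (hself true)
  rw [heq] at hp
  refine hdev ?_
  cases a
  · exact (G.antagonistic _ _).2 hp
  · exact (G.antagonistic _ _).1 hp

end Game

/-! ### Solving named games with the limit operator -/

theorem boundedFind_antitone {P Q : ℕ → Bool} {n : ℕ} (h : ∀ i, P i = true → Q i = true) :
    boundedFind Q n ≤ boundedFind P n := by
  rcases (boundedFind_le P n).lt_or_eq with hlt | heq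
  · exact boundedFind_le_of (h _ (boundedFind_spec hlt))
  · rw [heq]
    exact boundedFind_le _ _

open Classical in
theorem firstIndex_eq_boundedFind (n : ℕ) (U : ℕ → Set Cantor) (x : Cantor) :
    firstIndex n U x = boundedFind (fun i => decide (x ∈ U i)) n := by
  unfold firstIndex
  split_ifs with h
  · obtain ⟨h₁, h₂⟩ := Nat.find_spec h
    refine (boundedFind_eq_of h₁ (by simpa using h₂) fun j hj => ?_).symm
    have := Nat.find_min h hj
    simp only [not_and] at this
    simpa using this (hj.trans h₁)
  · refine le_antisymm ?_ (boundedFind_le _ _)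
    by_contra hlt
    rw [not_le, boundedFind_lt_iff] at hlt
    obtain ⟨i, hi, hx⟩ := hlt
    exact h ⟨i, hi, by simpa using hx⟩

theorem primrec_two_pow : Primrec fun n : ℕ => 2 ^ n :=
  (Primrec₂.unpaired'.1 Nat.Primrec.pow).comp (Primrec.const 2) Primrec.id

namespace NamedGame

/-- The player to move. -/
def turnOf (p : Baire) (u : List Bool) : Bool := decide (p (Nat.pair 1 (Encodable.encode u)) = 1)

/-- The name of the `m`-th outcome set of the first player. -/
def setName (p : Baire) (m j : ℕ) : ℕ := p (Nat.pair 3 (Nat.pair (Nat.pair 0 m) j))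

/-- The `i`-th open set in the name of the `m`-th outcome set is seen, within `u.length` steps, to
contain the cylinder of `u`. -/
def Seen (p : Baire) (m : ℕ) (u : List Bool) (i : ℕ) : Prop :=
  ∃ j, j < u.length ∧ ∃ l, l < u.length + 1 ∧
    setName p m (Nat.pair i j + 1) = Encodable.encode (u.take l) + 1

open Classical in
/-- The least index of an open set seen so far, and `n` if there is none. -/
noncomputable def levelOf (n : ℕ) (p : Baire) (m : ℕ) (u : List Bool) : ℕ :=
  boundedFind (fun i => decide (Seen p m u i)) n

/-- The player who wins a play of final level `l`, if the first player wants to reach the `m`-th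
outcome set. -/
def favOf (n : ℕ) (p : Baire) (m l : ℕ) : Bool :=
  xor (decide (setName p m 0 = 0)) (decide (l % 2 ≠ n % 2))

/-- The `m`-th row of a table of certificates. -/
def rowOf (c : Baire) (m : ℕ) (u : List Bool) : ℕ := c (Nat.pair m (Encodable.encode u))

/-- The word with code `e`. -/
def wordOf (e : ℕ) : List Bool := (Encodable.decode e).getD []

@[simp] theorem wordOf_encode (w : List Bool) : wordOf (Encodable.encode w) = w := by
  simp [wordOf]

/-- The table of certificates for the words of level at most `k`. -/
noncomputable def tableOf (n : ℕ) (p : Baire) (k : ℕ) : Baire := fun j =>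
  (leastCert (levelOf n p j.unpair.1) (favOf n p j.unpair.1) (turnOf p))^[k] (fun _ => 0)
    (wordOf j.unpair.2)

theorem rowOf_tableOf (n : ℕ) (p : Baire) (k m : ℕ) : rowOf (tableOf n p k) m =
    (leastCert (levelOf n p m) (favOf n p m) (turnOf p))^[k] fun _ => 0 := by
  funext u
  simp [rowOf, tableOf]

/-- The bit mask of the outcome set `Game.cut a o`. -/
def cutMask (p : Baire) (a : Bool) (o : ℕ) : ℕ :=
  Nat.rec (motive := fun _ => ℕ) 0 (fun i s =>
    if (a = false ∧ i = o) ∨ p (Nat.pair 2 (Nat.pair 0 (Nat.pair o i))) = 1 then s + 2 ^ i else s)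
    (p (Nat.pair 0 0))

/-- The winner from `u`, if the first player wants an outcome in `Game.cut a o`. -/
noncomputable def winOf (n : ℕ) (p c : Baire) (a : Bool) (o : ℕ) (u : List Bool) : Bool :=
  levelWinner (levelOf n p (cutMask p a o)) (favOf n p (cutMask p a o))
    (rowOf c (cutMask p a o)) u

/-- The strategies, if the first player wants an outcome in `Game.cut a o`. -/
noncomputable def stratOf (n : ℕ) (p c : Baire) (a : Bool) (o : ℕ) (u : List Bool) : Bool :=
  levelStrategy (levelOf n p (cutMask p a o)) (favOf n p (cutMask p a o)) (turnOf p)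
    (rowOf c (cutMask p a o)) u

/-- The value of the game from `u`. -/
noncomputable def valueOf (n : ℕ) (p c : Baire) (u : List Bool) : ℕ :=
  boundedFind (fun o => decide (winOf n p c false o u = false ∧ winOf n p c true o u = true))
    (p (Nat.pair 0 0))

/-- The equilibrium. -/
noncomputable def profileOf (n : ℕ) (p c : Baire) (u : List Bool) : Bool :=
  stratOf n p c (turnOf p u) (valueOf n p c u) u

/-! #### Correctness -/

theorem seen_append {p : Baire} {m i : ℕ} {u : List Bool} (b : Bool) (h : Seen p m u i) :
    Seen p m (u ++ [b]) i := by
  obtain ⟨j, hj, l, hl, he⟩ := h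
  refine ⟨j, by simp; omega, l, by simp; omega, ?_⟩
  rw [he, List.take_append_of_le_length (by omega)]

theorem levelOf_append (n : ℕ) (p : Baire) (m : ℕ) (u : List Bool) (b : Bool) :
    levelOf n p m (u ++ [b]) ≤ levelOf n p m u :=
  boundedFind_antitone fun i hi => by
    simp only [decide_eq_true_eq] at hi ⊢
    exact seen_append b hi

/-- An enumerated cylinder is noticed once the history exceeds its index and covers its word.
Nothing is noticed wrongly, since only prefixes of the history are compared. -/
theorem eventually_seen (p : Baire) (m i : ℕ) (x : Cantor) : ∀ᶠ k in atTop,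
    (Seen p m (prefixOf x k) i ↔
      x ∈ openOfName (Baire.sec (fun j => (p.sec 3).sec (Nat.pair 0 m) (j + 1)) i)) := by
  by_cases hx : x ∈ openOfName (Baire.sec (fun j => (p.sec 3).sec (Nat.pair 0 m) (j + 1)) i)
  · simp only [hx, iff_true]
    obtain ⟨j, w, hj, hw⟩ := hx
    filter_upwards [eventually_gt_atTop j, eventually_ge_atTop w.length] with k hk₁ hk₂
    refine ⟨j, by simpa using hk₁, w.length, by simp; omega, ?_⟩
    rw [take_prefixOf _ hk₂, mem_cylinder_iff.1 hw]
    exact hj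
  · simp only [hx, iff_false]
    refine Eventually.of_forall ?_
    rintro k ⟨j, hj, l, hl, he⟩
    simp only [length_prefixOf] at hl
    refine hx ⟨j, _, he, ?_⟩
    rw [take_prefixOf _ (by omega), mem_cylinder_iff, length_prefixOf]

theorem eventually_levelOf (n : ℕ) (p : Baire) (m : ℕ) (x : Cantor) : ∀ᶠ k in atTop,
    levelOf n p m (prefixOf x k) = firstIndex n
      (fun i => openOfName (Baire.sec (fun j => (p.sec 3).sec (Nat.pair 0 m) (j + 1)) i)) x := by
  have h := (Set.finite_lt_nat n).eventually_all.2 fun i _ => eventually_seen p m i x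
  filter_upwards [h] with k hk
  rw [firstIndex_eq_boundedFind]
  exact boundedFind_congr fun i hi => decide_eq_decide.2 (hk i hi)

theorem favOf_level {n : ℕ} {p : Baire} {m N l : ℕ} {x : Cantor}
    (h : ∀ k, N ≤ k → levelOf n p m (prefixOf x k) = l) :
    favOf n p m l = false ↔ x ∈ diffOrCodiffOfName n ((p.sec 3).sec (Nat.pair 0 m)) := by
  obtain ⟨k, hk₁, hk₂⟩ := ((eventually_levelOf n p m x).and (eventually_ge_atTop N)).exists
  rw [h k hk₂] at hk₁
  subst hk₁
  have h0 : setName p m 0 = (p.sec 3).sec (Nat.pair 0 m) 0 := rfl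
  unfold diffOrCodiffOfName favOf
  rw [h0]
  split_ifs with h₀
  · simp [h₀, diffOfName, diffSet]
  · simp [h₀, diffOfName, diffSet]

theorem testBit_maskSum (Q : ℕ → Prop) [DecidablePred Q] (k : ℕ) :
    (Nat.rec (motive := fun _ => ℕ) 0 (fun i s => if Q i then s + 2 ^ i else s) k : ℕ) < 2 ^ k ∧
    ∀ i, i < k → ((Nat.rec (motive := fun _ => ℕ) 0
      (fun i s => if Q i then s + 2 ^ i else s) k : ℕ).testBit i = true ↔ Q i) := by
  induction k with
  | zero => simp
  | succ k ih =>
    obtain ⟨h₁, h₂⟩ := ih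
    dsimp only
    generalize (Nat.rec (motive := fun _ => ℕ) 0
      (fun i s => if Q i then s + 2 ^ i else s) k : ℕ) = s at h₁ h₂
    have hbit := Nat.testBit_two_pow_mul_add 1 h₁
    have hpow : 2 ^ (k + 1) = 2 ^ k + 2 ^ k := by ring
    split_ifs with hQ
    · refine ⟨by omega, fun i hi => ?_⟩
      have := hbit i
      rw [mul_one, add_comm] at this
      rw [this]
      split_ifs with hik
      · exact h₂ i hik
      · obtain rfl : i = k := by omega
        simpa using hQ
    · refine ⟨by omega, fun i hi => ?_⟩
      rcases Nat.lt_succ_iff_lt_or_eq.1 hi with hik | rfl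
      · exact h₂ i hik
      · simp [Nat.testBit_lt_two_pow h₁, hQ]

section Correct

variable {n : ℕ} {p : Baire} {G : Game}

theorem turnOf_eq (h : Game.Names n p G) : turnOf p = G.turn := by
  funext w
  have := h.2.1 w
  simp only [Baire.sec] at this
  rw [turnOf, this]
  cases G.turn w <;> simp

theorem cutMask_spec (h : Game.Names n p G) (a : Bool) (o : Fin G.numOutcomes) :
    cutMask p a o < 2 ^ G.numOutcomes ∧
      Game.maskSet G.numOutcomes (cutMask p a o) = G.cut a o := by
  have h0 : p (Nat.pair 0 0) = G.numOutcomes := h.1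
  have hm := testBit_maskSum (fun i => (a = false ∧ i = (o : ℕ)) ∨
    p (Nat.pair 2 (Nat.pair 0 (Nat.pair o i))) = 1) G.numOutcomes
  unfold cutMask
  rw [h0]
  refine ⟨hm.1, ?_⟩
  ext o'
  refine (hm.2 o' o'.2).trans ?_
  have hp := h.2.2.1 false o o'
  simp only [Baire.sec, Bool.toNat_false] at hp
  rw [hp]
  simp [Game.cut, Fin.ext_iff]

theorem solves_winOf (h : Game.Names n p G) (a : Bool) (o : Fin G.numOutcomes) :
    Solves G.turn (G.val ⁻¹' G.cut a o) (winOf n p (tableOf n p n) a o)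
      (stratOf n p (tableOf n p n) a o) := by
  obtain ⟨hlt, hcut⟩ := cutMask_spec h a o
  rw [← turnOf_eq h]
  refine solves_levels (levelOf_append n p _) (fun w => ?_) fun x N l hl => ?_
  -- No level exceeds `n`, so `n` iterations already reach a fixed point of `leastCert`.
  · rw [rowOf_tableOf, ← Function.iterate_succ_apply' (leastCert _ _ _)]
    exact iterate_leastCert_succ n w (boundedFind_le _ _)
  · rw [favOf_level hl, ← hcut]
    have := h.2.2.2 false _ hlt (hcut ▸ G.isUpper_cut a o)
    simp only [Bool.toNat_false] at this
    rw [this]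

theorem valueOf_spec (h : Game.Names n p G) (w : List Bool) :
    ∃ o : Fin G.numOutcomes, valueOf n p (tableOf n p n) w = o ∧
      ∀ a, winOf n p (tableOf n p n) a o w = a := by
  have h0 : p (Nat.pair 0 0) = G.numOutcomes := h.1
  obtain ⟨o, ho⟩ := Game.exists_value (solves_winOf h) w
  have hlt : valueOf n p (tableOf n p n) w < p (Nat.pair 0 0) := by
    refine boundedFind_lt_iff.2 ⟨o, o.2.trans_eq h0.symm, ?_⟩
    rw [decide_eq_true (⟨ho false, ho true⟩)]
  have hs := boundedFind_spec hlt
  refine ⟨⟨_, hlt.trans_eq h0⟩, rfl, fun a => ?_⟩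
  have hs' := of_decide_eq_true hs
  cases a
  · exact hs'.1
  · exact hs'.2

theorem isSubgamePerfect_profileOf (h : Game.Names n p G) :
    G.IsSubgamePerfect (profileOf n p (tableOf n p n)) := by
  choose v hv hw using valueOf_spec h
  have := Game.isSubgamePerfect_of_solves (solves_winOf h) (v := v) hw
  convert this using 1
  funext w
  rw [profileOf, hv, turnOf_eq h]

end Correct

end NamedGame

/-! ### Computability of levels, certificates and their approximations -/

namespace NamedGame

open OracleComputable

theorem turnOf_computable : OracleComputable turnOf :=
  (eq (.query (.of_primrec (Primrec₂.natPair.comp (Primrec.const 1) Primrec.encode)))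
    (.const 1)).of_eq fun _ _ => rfl

theorem setName_computable : OracleComputable fun p (x : ℕ × ℕ) => setName p x.1 x.2 :=
  .query (.natPair (.const 3) (.natPair (.natPair (.const 0) OracleComputable.id.fst)
    OracleComputable.id.snd))

open scoped Classical in
theorem seen_computable :
    OracleComputable fun p (x : (ℕ × List Bool) × ℕ) => decide (Seen p x.1.1 x.1.2 x.2) := by
  have h₃ : OracleComputable fun _ (x : (((ℕ × List Bool) × ℕ) × ℕ) × ℕ) => x := .id
  have hu := h₃.fst.fst.fst.snd
  have key : OracleComputable fun p (x : (((ℕ × List Bool) × ℕ) × ℕ) × ℕ) =>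
      decide (setName p x.1.1.1.1 (Nat.pair x.1.1.2 x.1.2 + 1) =
        Encodable.encode (x.1.1.1.2.take x.2) + 1) :=
    eq (setName_computable.app₂ h₃.fst.fst.fst.fst
      (.map Primrec.succ (.natPair h₃.fst.fst.snd h₃.fst.snd)))
      (.map Primrec.succ (.encode (.map₂ Primrec.list_take h₃.snd hu)))
  have h₂ : OracleComputable fun _ (x : ((ℕ × List Bool) × ℕ) × ℕ) => x := .id
  have h₁ : OracleComputable fun _ (x : (ℕ × List Bool) × ℕ) => x := .id
  have key₂ := OracleComputable.exists_lt key (h := fun _ x => x.1.1.2.length + 1)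
    (.map Primrec.succ (.map Primrec.list_length h₂.fst.fst.snd))
  exact (OracleComputable.exists_lt key₂ (h := fun _ x => x.1.2.length)
    (.map Primrec.list_length h₁.fst.snd)).of_eq fun p x => decide_eq_decide.2 Iff.rfl

theorem levelOf_computable (n : ℕ) :
    OracleComputable fun p (x : ℕ × List Bool) => levelOf n p x.1 x.2 :=
  boundedFind (h := fun _ _ => n) seen_computable (.const n)

theorem favOf_computable (n : ℕ) : OracleComputable fun p (x : ℕ × ℕ) => favOf n p x.1 x.2 := by
  have hid : OracleComputable fun _ (x : ℕ × ℕ) => x := .id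
  exact .map₂ (Primrec.dom_bool₂ xor)
    (eq (setName_computable.app₂ hid.fst (.const 0)) (.const 0))
    (.not (eq (.map₂ Primrec.nat_mod hid.snd (.const 2)) (.const (n % 2))))

theorem rowOf_computable : OracleComputable fun c (x : ℕ × List Bool) => rowOf c x.1 x.2 :=
  .query (.natPair OracleComputable.id.fst (.encode OracleComputable.id.snd))

theorem wordOf_primrec : Primrec wordOf :=
  Primrec.option_getD.comp Primrec.decode (Primrec.const [])

theorem wordsOfCode_primrec : Primrec wordsOfCode :=
  Primrec.option_getD.comp Primrec.decode (Primrec.const [])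

/-- The even positions of a point of Baire space. -/
def evens (r : Baire) : Baire := fun j => r (2 * j)

/-- The odd positions of a point of Baire space. -/
def odds (r : Baire) : Baire := fun j => r (2 * j + 1)

@[simp] theorem evens_join (p q : Baire) : evens (Baire.join p q) = p := by
  funext j
  simp [evens]

@[simp] theorem odds_join (p q : Baire) : odds (Baire.join p q) = q := by
  funext j
  simp [odds]

theorem evens_computable : OracleComputable evens := .query (.of_primrec Primrec.nat_double)

theorem odds_computable : OracleComputable odds := .query (.of_primrec Primrec.nat_double_succ)

/-- The winner from a word according to a state, which consists of the name of a game and a table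
of certificates. -/
noncomputable def stateWinner (n : ℕ) (r : Baire) (x : ℕ × List Bool) : Bool :=
  levelWinner (levelOf n (evens r) x.1) (favOf n (evens r) x.1) (rowOf (odds r) x.1) x.2

theorem stateWinner_computable (n : ℕ) : OracleComputable (stateWinner n) := by
  have hid : OracleComputable fun _ (x : ℕ × List Bool) => x := .id
  have hf : OracleComputable fun r (x : ℕ × List Bool) =>
      favOf n (evens r) x.1 (levelOf n (evens r) x.1 x.2) :=
    ((favOf_computable n).subst evens_computable).app₂ hid.fst
      ((levelOf_computable n).subst evens_computable)
  exact .ite (eq (rowOf_computable.subst odds_computable) (.const 0)) hf (.map Primrec.not hf)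

theorem append_primrec (b : Bool) : Primrec fun u : List Bool => u ++ [b] :=
  Primrec.list_concat.comp Primrec.id (Primrec.const b)

open scoped Classical in
theorem mem_computable {α : Type*} [Primcodable α] {u : Baire → α → List Bool}
    {F : Baire → α → List (List Bool)} (hu : OracleComputable u) (hF : OracleComputable F) :
    OracleComputable fun p x => decide (u p x ∈ F p x) := by
  have h := PrimrecRel.exists_mem_list (R := fun a b : List Bool => a = b) Primrec.eq
  refine (map₂ (f := fun (L : List (List Bool)) b => decide (∃ a ∈ L, a = b)) h.decide hF
    hu).of_eq fun p x => ?_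
  simp

open scoped Classical in
theorem certStep_computable (n : ℕ) :
    OracleComputable fun r (x : (ℕ × ℕ × List (List Bool)) × List Bool) =>
      decide (CertStep (levelOf n (evens r) x.1.1) (favOf n (evens r) x.1.1) (turnOf (evens r))
        (rowOf (odds r) x.1.1) x.1.2.1 x.1.2.2 x.2) := by
  have hid : OracleComputable fun _ (x : (ℕ × ℕ × List (List Bool)) × List Bool) => x := .id
  have hm := hid.fst.fst
  have hl := hid.fst.snd.fst
  have hF := hid.fst.snd.snd
  have hu := hid.snd
  have hlev := ((levelOf_computable n).subst evens_computable).app₂ hm hu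
  have hnf : OracleComputable fun r (x : (ℕ × ℕ × List (List Bool)) × List Bool) =>
      !favOf n (evens r) x.1.1 x.1.2.1 :=
    .map Primrec.not (((favOf_computable n).subst evens_computable).app₂ hm hl)
  have hwin := (stateWinner_computable n).app₂ hm hu
  have hch := fun b => mem_computable (.map (append_primrec b) hu) hF
  exact (OracleComputable.or (.and (.lt hlev hl) (.eq hwin hnf)) (.and (.eq hlev hl)
    (.or (.and (hch false) (hch true)) (.and (.eq ((turnOf_computable.subst
      evens_computable).comp hu) hnf) (.or (hch false) (hch true)))))).of_eq
        fun r x => decide_eq_decide.2 Iff.rfl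

open scoped Classical in
theorem isCertCode_computable (n : ℕ) :
    OracleComputable fun r (x : (ℕ × List Bool) × ℕ) =>
      decide (IsCertCode (levelOf n (evens r) x.1.1) (favOf n (evens r) x.1.1) (turnOf (evens r))
        (rowOf (odds r) x.1.1) x.1.2 x.2) := by
  have hid : OracleComputable fun _ (x : (ℕ × List Bool) × ℕ) => x := .id
  have hF := hid.snd.map wordsOfCode_primrec
  have h₂ : OracleComputable fun _ (x : ((ℕ × List Bool) × ℕ) × List Bool) => x := .id
  have key := (certStep_computable n).comp ((h₂.fst.fst.fst.pair
    ((((levelOf_computable n).subst evens_computable).app₂ h₂.fst.fst.fst h₂.fst.fst.snd).pair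
      (h₂.fst.snd.map wordsOfCode_primrec))).pair h₂.snd)
  exact (OracleComputable.and (mem_computable hid.fst.snd hF) (forall_mem key hF)).of_eq
    fun r x => decide_eq_decide.2 Iff.rfl

open Classical in
/-- The approximation to `succLeast P` from the numbers less than `s`. -/
noncomputable def succLeastBelow (P : ℕ → Prop) (s : ℕ) : ℕ :=
  if _root_.boundedFind (fun j => decide (P j)) s < s then
    _root_.boundedFind (fun j => decide (P j)) s + 1 else 0

/-- The search for certificates among the codes less than a given bound. -/
noncomputable def approxCert (n : ℕ) (r : Baire) (x : (ℕ × List Bool) × ℕ) : ℕ :=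
  succLeastBelow (IsCertCode (levelOf n (evens r) x.1.1) (favOf n (evens r) x.1.1)
    (turnOf (evens r)) (rowOf (odds r) x.1.1) x.1.2) x.2

theorem approxCert_computable (n : ℕ) : OracleComputable (approxCert n) := by
  have hid : OracleComputable fun _ (x : (ℕ × List Bool) × ℕ) => x := .id
  have h₂ : OracleComputable fun _ (x : ((ℕ × List Bool) × ℕ) × ℕ) => x := .id
  have hb := boundedFind ((isCertCode_computable n).comp (h₂.fst.fst.pair h₂.snd)) hid.snd
  exact .ite (.lt hb hid.snd) (.map Primrec.succ hb) (.const 0)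

open scoped Classical in
-- This is what one limit buys: an unbounded search is the eventual value of bounded ones, including
-- the verdict that nothing is found.
theorem eventually_succLeastBelow (P : ℕ → Prop) :
    ∀ᶠ s in atTop, succLeastBelow P s = succLeast P := by
  unfold succLeast
  split_ifs with h
  · filter_upwards [eventually_gt_atTop (Nat.find h)] with s hs
    rw [succLeastBelow, boundedFind_eq_of hs (by simpa using Nat.find_spec h)
      fun j hj => by simpa using Nat.find_min h hj, if_pos hs]
  · refine Eventually.of_forall fun s => if_neg ?_
    rw [boundedFind_lt_iff]
    rintro ⟨i, -, hi⟩
    exact h ⟨i, by simpa using hi⟩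

/-- The name of the game is carried along with the table, because the search for the next table
consults both. -/
theorem tableOf_limComputable (n k : ℕ) :
    LimComputable k fun p => {Baire.join p (tableOf n p k)} := by
  induction k with
  | zero =>
    have hz : OracleComputable fun _ (_ : ℕ) => (0 : ℕ) := .const 0
    refine RelComputable.mono (RelComputable.join RelComputable.id (RelComputable.of_oracle hz))
      fun p q hq => ⟨p, rfl, _, rfl, hq⟩
  | succ k ih =>
    have hid : OracleComputable fun _ (j : ℕ) => j := .id
    have hu := hid.map Primrec.unpair
    have hu' := hu.fst.map Primrec.unpair
    have ha : OracleComputable fun r (j : ℕ) => approxCert n r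
        ((j.unpair.1.unpair.1, wordOf j.unpair.1.unpair.2), j.unpair.2) :=
      (approxCert_computable n).comp ((hu'.fst.pair (hu'.snd.map wordOf_primrec)).pair hu.snd)
    have hnext : LimComputable (k + 1) fun p => {tableOf n p (k + 1)} := by
      refine ⟨_, LimComputable.comp_rel (RelComputable.of_oracle ha) ih, ?_⟩
      rintro p _ rfl
      refine ⟨_, ⟨_, rfl, rfl⟩, fun j => ?_⟩
      filter_upwards [eventually_succLeastBelow (IsCertCode (levelOf n p j.unpair.1)
        (favOf n p j.unpair.1) (turnOf p) (rowOf (tableOf n p k) j.unpair.1)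
          (wordOf j.unpair.2))] with s hs
      rw [tableOf, Function.iterate_succ_apply', ← rowOf_tableOf, leastCert, ← hs]
      simp only [Baire.sec, Nat.unpair_pair, approxCert, evens_join, odds_join]
    refine LimComputable.mono (LimComputable.join (LimComputable.of_rel RelComputable.id) hnext) ?_
    exact fun p q hq => ⟨p, rfl, _, rfl, hq⟩

/-! #### Computing the equilibrium from a complete table -/

theorem cutMask_computable : OracleComputable fun p (x : Bool × ℕ) => cutMask p x.1 x.2 := by
  have hid : OracleComputable fun _ (x : (Bool × ℕ) × ℕ × ℕ) => x := .id
  refine nat_rec (g := fun p (x : (Bool × ℕ) × ℕ × ℕ) =>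
    if (x.1.1 = false ∧ x.2.1 = x.1.2) ∨ p (Nat.pair 2 (Nat.pair 0 (Nat.pair x.1.2 x.2.1))) = 1
    then x.2.2 + 2 ^ x.2.1 else x.2.2) (.const 0) ?_ (.query (.const _))
  exact .ite (.or (.and (.eq hid.fst.fst (.const false)) (.eq hid.snd.fst hid.fst.snd))
    (.eq (.query (.natPair (.const 2) (.natPair (.const 0) (.natPair hid.fst.snd hid.snd.fst))))
      (.const 1))) (.add hid.snd.snd (hid.snd.fst.map primrec_two_pow)) hid.snd.snd

theorem winOf_computable (n : ℕ) : OracleComputable fun r (x : (Bool × ℕ) × List Bool) =>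
    winOf n (evens r) (odds r) x.1.1 x.1.2 x.2 :=
  (stateWinner_computable n).app₂
    ((cutMask_computable.subst evens_computable).comp OracleComputable.id.fst)
    OracleComputable.id.snd

theorem stratOf_computable (n : ℕ) : OracleComputable fun r (x : (Bool × ℕ) × List Bool) =>
    stratOf n (evens r) (odds r) x.1.1 x.1.2 x.2 := by
  have hid : OracleComputable fun _ (x : (Bool × ℕ) × List Bool) => x := .id
  have hm := (cutMask_computable.subst evens_computable).comp hid.fst
  have hlev := ((levelOf_computable n).subst evens_computable).app₂ hm hid.snd
  have hfav := ((favOf_computable n).subst evens_computable).app₂ hm hlev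
  have hturn := (turnOf_computable.subst evens_computable).comp hid.snd
  have hrow := (rowOf_computable.subst odds_computable).app₂ hm hid.snd
  have hw := hid.snd.map (append_primrec true)
  classical
  refine (ite (.eq hturn hfav) (.eq ((stateWinner_computable n).app₂ hm hw) hturn)
    (mem_computable hw ((hrow.map Primrec.pred).map wordsOfCode_primrec))).of_eq fun r x => ?_
  simp only [stratOf, levelStrategy, stateWinner, Nat.pred_eq_sub_one]
  congr 1

theorem valueOf_computable (n : ℕ) : OracleComputable fun r (u : List Bool) =>
    valueOf n (evens r) (odds r) u := by
  have hid : OracleComputable fun _ (x : List Bool × ℕ) => x := .id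
  have h := fun b : Bool => eq ((winOf_computable n).comp
    (((OracleComputable.const b).pair hid.snd).pair hid.fst)) (.const b)
  exact boundedFind (P := fun r (x : List Bool × ℕ) =>
    decide (winOf n (evens r) (odds r) false x.2 x.1 = false ∧
      winOf n (evens r) (odds r) true x.2 x.1 = true)) (.and (h false) (h true))
    ((query (f := fun _ _ => Nat.pair 0 0) (.const _)).subst evens_computable)

theorem profileOf_computable (n : ℕ) : OracleComputable fun r (u : List Bool) =>
    profileOf n (evens r) (odds r) u :=
  ((stratOf_computable n).comp (((turnOf_computable.subst evens_computable).pair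
    (valueOf_computable n)).pair .id)).of_eq fun _ _ => rfl

end NamedGame

/-! ### Existence of equilibria and the upper bound -/

theorem SPE_nonempty (n : ℕ) (G : (gameSpace n).Carrier) : (SPE n G).Nonempty := by
  obtain ⟨p, hp⟩ := (gameSpace n).names_surj G
  exact ⟨_, NamedGame.isSubgamePerfect_profileOf hp⟩

theorem SPE_weihrauchLE (n : ℕ) : (SPE n).WeihrauchLE (limPow n) := by
  have h : OracleComputable fun r (j : ℕ) =>
      (NamedGame.profileOf n (NamedGame.evens r) (NamedGame.odds r) (NamedGame.wordOf j)).toNat :=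
    .map (Primrec.dom_bool _) ((NamedGame.profileOf_computable n).comp
      (.of_primrec NamedGame.wordOf_primrec))
  refine MultiFun.weihrauchLE_limPow (LimComputable.comp_rel (RelComputable.of_oracle h)
    (NamedGame.tableOf_limComputable n n)) fun p G hp _ => ?_
  refine ⟨_, ⟨_, rfl, rfl⟩, _, NamedGame.isSubgamePerfect_profileOf hp, fun w => ?_⟩
  simp

/-! ### Reducing iterated limits to games -/

namespace LimGame

/-! #### Alternating questions about an iterated limit -/

/-- A question `(m, t, k, b)` about a point `p`: with `b = false` whether `p m = k`, and with
`b = true` whether `p m ≠ k`; the bound `t` is used by `truth`. -/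
abbrev Question : Type := ℕ × ℕ × ℕ × Bool

/-- The question that is asked after the choice of `x`. -/
def step (c : Question) (x : ℕ) : Question :=
  (Nat.pair c.1 (c.2.1 + x.unpair.1), x.unpair.2, c.2.2.1, !c.2.2.2)

/-- The answer to a question without further alternations. -/
def atom (p : Baire) (c : Question) : Bool := xor (decide (p c.1 = c.2.2.1)) c.2.2.2

/-- The answer to a question with `j` alternations. -/
def truth (p : Baire) : ℕ → Question → Prop
  | 0, c => atom p c = true
  | j + 1, c => ∃ x, ¬ truth p j (step c x)

/-- Replacing a value of a limit by its approximations costs one alternation: the value has a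
property exactly if, from some `t'` on, no approximation has the opposite one. The chosen number
codes the offset `i - t` and this `t'`, and the flag flips with the negation. -/
theorem truth_succ_iff {n : ℕ} {p q : Baire} (h : q ∈ limPow n p) (m t k : ℕ) (b : Bool) :
    truth p (n + 1) (m, t, k, b) ↔
      ∃ i, t ≤ i ∧ xor (decide (q (Nat.pair m i) = k)) b = true := by
  induction n generalizing q m t b with
  | zero =>
    obtain rfl := mem_limPow_zero.1 h
    simp only [truth, step, atom]
    constructor
    · rintro ⟨x, hx⟩
      refine ⟨t + x.unpair.1, by omega, ?_⟩
      revert hx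
      by_cases hk : q (Nat.pair m (t + x.unpair.1)) = k <;> cases b <;> simp [hk]
    · rintro ⟨i, hi, hx⟩
      -- The second component becomes the next bound, which `atom` does not read.
      refine ⟨Nat.pair (i - t) 0, ?_⟩
      simp only [Nat.unpair_pair, Nat.add_sub_cancel' hi]
      revert hx
      cases b <;> simp
  | succ n ih =>
    obtain ⟨y, hy, hq⟩ := mem_limPow_succ'.1 h
    have key : ∀ i t', truth p (n + 1) (Nat.pair m i, t', k, !b) ↔
        ∃ j, t' ≤ j ∧ xor (decide (y (Nat.pair (Nat.pair m i) j) = k)) (!b) = true :=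
      fun i t' => ih hy _ _ _
    rw [truth]
    simp only [step]
    constructor
    · rintro ⟨x, hx⟩
      rw [key] at hx
      refine ⟨t + x.unpair.1, by omega, ?_⟩
      -- One index beyond the bound at which the approximation has reached its limit suffices.
      obtain ⟨j, hj₁, hj₂⟩ := ((hq (Nat.pair m (t + x.unpair.1))).and
        (eventually_ge_atTop x.unpair.2)).exists
      by_contra hn
      refine hx ⟨j, hj₂, ?_⟩
      change y _ = _ at hj₁
      rw [hj₁]
      revert hn
      cases b <;> simp
    · rintro ⟨i, hi, hx⟩
      obtain ⟨t', ht'⟩ := eventually_atTop.1 (hq (Nat.pair m i))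
      refine ⟨Nat.pair (i - t) t', ?_⟩
      simp only [Nat.unpair_pair, Nat.add_sub_cancel' hi]
      rw [key]
      rintro ⟨j, hj, hj'⟩
      have hyq := ht' j hj
      change y _ = _ at hyq
      rw [hyq] at hj'
      revert hx hj'
      cases b <;> simp

/-! #### The game -/

/-- The positions of the game: the phase, the number of moves `false` since the last move `true`,
and the current question. In phase `n + 3` the question is chosen, in phase `n + 2` the first
player decides between a neutral outcome (phase `0`) and the question; in phase `j + 2` there are
`j + 1` numbers still to be chosen, and in phase `1` the answer is determined. -/
abbrev Position : Type := ℕ × ℕ × Question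

/-- The question with a given code. -/
def questionOf (z : ℕ) : Question := (z.unpair.1, z.unpair.2.unpair.1, z.unpair.2.unpair.2, true)

/-- The effect of a move. -/
def move (n : ℕ) (s : Position) (b : Bool) : Position :=
  if s.1 = n + 3 then (if b = true then (n + 2, 0, questionOf s.2.1) else (n + 3, s.2.1 + 1, s.2.2))
  else if s.1 = n + 2 then (if b = true then (0, 0, s.2.2) else (n + 1, 0, s.2.2))
  else if s.1 < 2 then s
  else if b = true then (s.1 - 1, 0, step s.2.2 s.2.1) else (s.1, s.2.1 + 1, s.2.2)

/-- The position after the moves `w`. -/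
def position (n : ℕ) (w : List Bool) : Position :=
  w.foldl (move n) (n + 3, 0, 0, 0, 0, false)

theorem position_append (n : ℕ) (w : List Bool) (b : Bool) :
    position n (w ++ [b]) = move n (position n w) b := by
  simp [position]

/-- The player to move in a given phase. -/
def turnOfPhase (n f : ℕ) : Bool := if n + 2 ≤ f then false else decide ((f + n) % 2 = 0)

/-- The level of a position, where `l` is the level of the neutral phase. -/
def level (n : ℕ) (p : Baire) (l : ℕ) (s : Position) : ℕ :=
  if s.1 = 0 then l
  else if s.1 = 1 then (if atom p s.2.2 = true then 1 else 0)
  else if s.1 ≤ n + 1 then s.1 - 1 else n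

/-- The levels for the outcome set with bit mask `m`. -/
def maskLevel (n : ℕ) (p : Baire) (m : ℕ) (w : List Bool) : ℕ :=
  if m = 4 ∨ m = 3 then level n p n (position n w)
  else if m = 6 ∨ m = 1 then level n p (n - 1) (position n w)
  else n

/-- Whether the outcome set with bit mask `m` is presented by its complement. -/
def maskFlag (m : ℕ) : ℕ := if m = 1 ∨ m = 3 ∨ m = 7 then 1 else 0

/-- The open sets of plays whose level drops to `i` or below. -/
def levelSet (L : List Bool → ℕ) (i : ℕ) : Set Cantor := {x | ∃ k, L (prefixOf x k) ≤ i}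

/-- The set in the difference hierarchy defined by the levels. -/
def maskDiff (n : ℕ) (p : Baire) (m : ℕ) : Set Cantor := diffSet n (levelSet (maskLevel n p m))

open Classical in
/-- The outcome of a play: `2` if the first player wins the question, `1` if he chose the neutral
outcome, and `0` otherwise. -/
noncomputable def outcome (n : ℕ) (p : Baire) (x : Cantor) : Fin 3 :=
  if x ∈ maskDiff n p 4 then 2 else if x ∈ maskDiff n p 6 then 1 else 0

/-- The game for the questions about the iterated limit of `p`. -/
noncomputable def game (n : ℕ) (p : Baire) : Game where
  numOutcomes := 3
  outcomes_nonempty := by norm_num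
  turn w := turnOfPhase n (position n w).1
  pref a o o' := if a = true then o' < o else o < o'
  pref_linear a := by
    cases a
    · simp only [Bool.false_eq_true, if_false]
      infer_instance
    · simp only [if_true]
      exact { trichotomous := fun a b h h' => le_antisymm (not_lt.1 h) (not_lt.1 h')
              irrefl := fun a => lt_irrefl a
              trans := fun a b c h h' => lt_trans h' h }
  antagonistic o o' := by simp
  val := outcome n p

/-! #### Levels and outcomes -/

theorem firstIndex_levelSet {n N l : ℕ} {L : List Bool → ℕ} {x : Cantor}
    (hL : ∀ w b, L (w ++ [b]) ≤ L w) (h : ∀ k, N ≤ k → L (prefixOf x k) = l) (hl : l ≤ n) :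
    firstIndex n (levelSet L) x = l := by
  have hanti : Antitone fun k => L (prefixOf x k) := antitone_nat_of_succ_le fun k => by
    rw [prefixOf_succ]
    exact hL _ _
  have hmem : ∀ i, x ∈ levelSet L i ↔ l ≤ i := by
    intro i
    constructor
    · rintro ⟨k, hk⟩
      rw [← h (max k N) (le_max_right _ _)]
      exact (hanti (le_max_left k N)).trans hk
    · intro hi
      exact ⟨N, (h N le_rfl).trans_le hi⟩
  classical
  rw [firstIndex_eq_boundedFind]
  rcases hl.lt_or_eq with hlt | rfl
  · exact boundedFind_eq_of hlt (by simp [hmem]) fun j hj => by simpa [hmem] using hj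
  · refine le_antisymm (boundedFind_le _ _) ?_
    by_contra hlt
    rw [not_le, boundedFind_lt_iff] at hlt
    obtain ⟨i, hi, hx⟩ := hlt
    rw [decide_eq_true_eq, hmem] at hx
    omega

theorem firstIndex_congr {n : ℕ} {U V : ℕ → Set Cantor} {x : Cantor}
    (h : ∀ i, x ∈ U i ↔ x ∈ V i) : firstIndex n U x = firstIndex n V x := by
  classical
  rw [firstIndex_eq_boundedFind, firstIndex_eq_boundedFind]
  exact boundedFind_congr fun i _ => decide_eq_decide.2 (h i)

/-- For `n = 0` this would fail: refusing the neutral outcome would lead straight to phase `1`,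
whose level can be `1`. -/
theorem level_move {n : ℕ} (hn : 0 < n) (p : Baire) {l : ℕ} (hl : l ≤ n) (s : Position) (b : Bool) :
    level n p l (move n s b) ≤ level n p l s := by
  obtain ⟨f, z, c⟩ := s
  have hat : ∀ c, (if atom p c = true then 1 else 0) ≤ 1 := fun c => by split_ifs <;> omega
  by_cases h₃ : f = n + 3
  · subst h₃
    cases b <;> simp [move, level]
  by_cases h₂ : f = n + 2
  · subst h₂
    cases b
    · simp [move, level, hn.ne']
    · simpa [move, level] using hl
  by_cases h₁ : f < 2
  · simp [move, h₃, h₂, h₁]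
  cases b
  · simp [move, level, h₃, h₂, h₁]
  · have hf : f ≠ 0 := by omega
    have hf₁ : f ≠ 1 := by omega
    have hf₀ : f - 1 ≠ 0 := by omega
    simp only [move, level, h₃, h₂, h₁, hf, hf₁, hf₀, if_false, if_true]
    have := hat (step c z)
    split_ifs at this ⊢ <;> omega

theorem maskLevel_append {n : ℕ} (hn : 0 < n) (p : Baire) (m : ℕ) (w : List Bool) (b : Bool) :
    maskLevel n p m (w ++ [b]) ≤ maskLevel n p m w := by
  unfold maskLevel
  rw [position_append]
  split_ifs
  · exact level_move hn p le_rfl _ _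
  · exact level_move hn p (Nat.sub_le _ _) _ _
  · exact le_rfl

theorem mem_maskDiff_iff {n N l m : ℕ} {p : Baire} {x : Cantor} (hn : 0 < n)
    (h : ∀ k, N ≤ k → maskLevel n p m (prefixOf x k) = l) (hl : l ≤ n) :
    x ∈ maskDiff n p m ↔ l % 2 ≠ n % 2 := by
  rw [maskDiff, diffSet, Set.mem_ofPred_eq, firstIndex_levelSet (maskLevel_append hn p m) h hl]

theorem neutral_of_le {n N : ℕ} {x : Cantor} (h : (position n (prefixOf x N)).1 = 0) :
    ∀ k, N ≤ k → (position n (prefixOf x k)).1 = 0 := by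
  intro k hk
  induction k, hk using Nat.le_induction with
  | base => exact h
  | succ k hk ih =>
    rw [prefixOf_succ, position_append, move]
    simp [ih]

/-- Neutral plays lie outside the smaller set, and on all other plays the two level functions agree.
So the two sets are the plays of outcome `2` and of outcome at least `1`. -/
theorem maskDiff_subset (n : ℕ) (p : Baire) : maskDiff n p 4 ⊆ maskDiff n p 6 := by
  intro x hx
  rcases n.eq_zero_or_pos with rfl | hn
  · simp only [maskDiff, diffSet, Set.mem_ofPred_eq, firstIndex_eq_boundedFind, boundedFind] at hx
    exact absurd rfl hx
  have hne : ∀ k, (position n (prefixOf x k)).1 ≠ 0 := by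
    intro N hN
    have := (mem_maskDiff_iff (N := N) (l := n) hn (fun k hk => ?_) le_rfl).1 hx
    · exact this rfl
    · simp [maskLevel, level, neutral_of_le hN k hk]
  have hl : ∀ k, maskLevel n p 4 (prefixOf x k) = maskLevel n p 6 (prefixOf x k) := by
    intro k
    simp [maskLevel, level, hne k]
  rw [maskDiff, diffSet, Set.mem_ofPred_eq] at hx ⊢
  rwa [← firstIndex_congr (U := levelSet (maskLevel n p 4))]
  intro i
  simp only [levelSet, Set.mem_ofPred_eq, hl]

theorem outcome_eq_two_iff {n : ℕ} {p : Baire} {x : Cantor} :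
    outcome n p x = 2 ↔ x ∈ maskDiff n p 4 := by
  unfold outcome
  split_ifs with h h' <;> simp [h]

theorem outcome_eq_zero_iff {n : ℕ} {p : Baire} {x : Cantor} :
    outcome n p x = 0 ↔ x ∉ maskDiff n p 6 := by
  unfold outcome
  split_ifs with h h'
  · simpa using maskDiff_subset n p h
  · simpa using h'
  · simpa using h'

/-- The outcome preferred most by a player. -/
def best (a : Bool) : Fin 3 := if a = true then 0 else 2

theorem outcome_of_level {n N l : ℕ} {p : Baire} {x : Cantor} {a : Bool} (hn : 0 < n)
    (h : ∀ k, N ≤ k → (position n (prefixOf x k)).1 ≠ 0 ∧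
      level n p n (position n (prefixOf x k)) = l) (hl : l ≤ n)
    (ha : a = decide (l % 2 = n % 2)) : outcome n p x = best a := by
  have h₄ := mem_maskDiff_iff (m := 4) (p := p) (x := x) (N := N) hn
    (fun k hk => by simpa [maskLevel] using (h k hk).2) hl
  have h₆ := mem_maskDiff_iff (m := 6) (p := p) (x := x) (N := N) (l := l) hn (fun k hk => by
    have := (h k hk).2
    simp only [level, (h k hk).1, if_false] at this
    simpa [maskLevel, level, (h k hk).1] using this) hl
  rw [ha]
  by_cases hp : l % 2 = n % 2
  · rw [decide_eq_true hp]
    exact outcome_eq_zero_iff.2 fun hx => h₆.1 hx hp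
  · rw [decide_eq_false hp]
    exact outcome_eq_two_iff.2 (h₄.2 hp)

/-- Neutral plays end at level `n` for `{2}` and at level `n - 1` for `{1, 2}`; the parities exclude
them from the first set and put them into the second. -/
theorem outcome_of_neutral {n N : ℕ} {p : Baire} {x : Cantor} (hn : 0 < n)
    (h : (position n (prefixOf x N)).1 = 0) : outcome n p x = 1 := by
  have h₄ := mem_maskDiff_iff (m := 4) (p := p) (x := x) (N := N) (l := n) hn
    (fun k hk => by simp [maskLevel, level, neutral_of_le h k hk]) le_rfl
  have h₆ := mem_maskDiff_iff (m := 6) (p := p) (x := x) (N := N) (l := n - 1) hn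
    (fun k hk => by simp [maskLevel, level, neutral_of_le h k hk]) (by omega)
  have h₁ : x ∉ maskDiff n p 4 := fun hx => h₄.1 hx rfl
  have h₂ : x ∈ maskDiff n p 6 := h₆.2 (by omega)
  simp [outcome, h₁, h₂]

end LimGame

/-! #### Values of subgame-perfect equilibria -/

namespace Game

theorem eq_of_prefixOf {x y : Cantor} {N : ℕ}
    (h : ∀ d, prefixOf x (N + d) = prefixOf y (N + d)) : x = y := by
  funext i
  have := congrArg (fun l : List Bool => l[i]?) (h (i + 1))
  have hi : i < N + (i + 1) := by omega
  simpa [prefixOf, hi] using this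

theorem historyFrom_add (s : List Bool → Bool) (w : List Bool) (j d : ℕ) :
    historyFrom s (historyFrom s w j) d = historyFrom s w (j + d) := by
  induction d with
  | zero => rfl
  | succ d ih => rw [historyFrom, ih, ← add_assoc, historyFrom]

theorem play_historyFrom (s : List Bool → Bool) (w : List Bool) (j : ℕ) :
    play s (historyFrom s w j) = play s w := by
  refine eq_of_prefixOf (N := w.length + j) fun d => ?_
  have := prefixOf_play s (historyFrom s w j) d
  rw [length_historyFrom] at this
  rw [this, historyFrom_add, add_assoc, prefixOf_play]

theorem play_append (s : List Bool → Bool) (w : List Bool) : play s (w ++ [s w]) = play s w :=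
  play_historyFrom s w 1

theorem play_congr {s s' : List Bool → Bool} {w : List Bool}
    (h : ∀ u, w.length ≤ u.length → s' u = s u) : play s' w = play s w := by
  have hh : ∀ d, historyFrom s' w d = historyFrom s w d := by
    intro d
    induction d with
    | zero => rfl
    | succ d ih => rw [historyFrom, historyFrom, ih, h _ (by simp)]
  refine eq_of_prefixOf (N := w.length) fun d => ?_
  rw [prefixOf_play, prefixOf_play, hh]

/-- Only the move at `w` is changed. All later histories are longer than `w`, so play continues
there as under `s`. -/
theorem IsSubgamePerfect.not_pref_append {G : Game} {s : List Bool → Bool}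
    (h : G.IsSubgamePerfect s) (w : List Bool) (b : Bool) :
    ¬ G.pref (G.turn w) (G.val (play s w)) (G.val (play s (w ++ [b]))) := by
  classical
  have hd := h w (G.turn w) (Function.update s w b) fun u hu =>
    Function.update_of_ne (fun e => hu (congrArg G.turn e)) _ _
  have hp := play_append (Function.update s w b) w
  rw [Function.update_self] at hp
  have hc : play (Function.update s w b) (w ++ [b]) = play s (w ++ [b]) := by
    refine play_congr fun u hu => Function.update_of_ne (fun e => ?_) _ _
    rw [e] at hu
    simp at hu
  rwa [← hp, hc] at hd

end Game

namespace LimGame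

variable {n : ℕ} {p : Baire} {s : List Bool → Bool}

/-- The answer to a question if the number to be chosen next is at least `z`. -/
def truthFrom (p : Baire) : ℕ → ℕ → Question → Prop
  | 0, _, c => atom p c = true
  | j + 1, z, c => ∃ x, z ≤ x ∧ ¬ truth p j (step c x)

theorem truthFrom_zero (p : Baire) (j : ℕ) (c : Question) : truthFrom p j 0 c ↔ truth p j c := by
  cases j <;> simp [truthFrom, truth]

/-- The player who chooses when `j` numbers are still to be chosen. -/
def chooser (n j : ℕ) : Bool := decide ((j + 1 + n) % 2 = 0)

theorem chooser_succ (n j : ℕ) : chooser n (j + 1) = !chooser n j := by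
  unfold chooser
  by_cases h : (j + 1 + n) % 2 = 0
  · have : ¬ (j + 1 + 1 + n) % 2 = 0 := by omega
    rw [decide_eq_true h, decide_eq_false this]
    rfl
  · have : (j + 1 + 1 + n) % 2 = 0 := by omega
    rw [decide_eq_true this, decide_eq_false h]
    rfl

theorem eq_best_of_not_pref {a : Bool} {o : Fin 3}
    (h : ¬ (if a = true then best a < o else o < best a)) : o = best a := by
  revert h
  cases a <;> fin_cases o <;> simp [best]

theorem position_true {j z : ℕ} {c : Question} {w : List Bool} (hj : j + 1 ≤ n)
    (hw : position n w = (j + 2, z, c)) : position n (w ++ [true]) = (j + 1, 0, step c z) := by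
  have h₁ : j + 2 ≠ n + 3 := by omega
  have h₂ : j + 2 ≠ n + 2 := by omega
  have h₃ : ¬ j + 2 < 2 := by omega
  rw [position_append, hw, move, if_neg h₁, if_neg h₂, if_neg h₃, if_pos rfl]
  rfl

theorem position_false {j z : ℕ} {c : Question} {w : List Bool} (hj : j + 1 ≤ n)
    (hw : position n w = (j + 2, z, c)) : position n (w ++ [false]) = (j + 2, z + 1, c) := by
  have h₁ : j + 2 ≠ n + 3 := by omega
  have h₂ : j + 2 ≠ n + 2 := by omega
  have h₃ : ¬ j + 2 < 2 := by omega
  rw [position_append, hw, move, if_neg h₁, if_neg h₂, if_neg h₃, if_neg Bool.false_ne_true]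

theorem turn_eq_chooser {j z : ℕ} {c : Question} {w : List Bool} (hj : j + 1 ≤ n)
    (hw : position n w = (j + 2, z, c)) : (game n p).turn w = chooser n (j + 1) := by
  change turnOfPhase n (position n w).1 = _
  rw [hw, turnOfPhase, if_neg (by dsimp only; omega)]
  rfl

theorem value_eq_of_answer (hn : 0 < n) {w : List Bool} {z : ℕ} {c : Question} (s)
    (hw : position n w = (1, z, c)) :
    outcome n p (Game.play s w) = best (if atom p c = true then chooser n 0 else !chooser n 0) := by
  have hpos : ∀ k, w.length ≤ k → position n (prefixOf (Game.play s w) k) = (1, z, c) := by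
    intro k hk
    induction k, hk using Nat.le_induction with
    | base => rwa [Game.prefixOf_play_length]
    | succ k hk ih =>
      have h₁ : 1 ≠ n + 3 := by omega
      have h₂ : 1 ≠ n + 2 := by omega
      rw [prefixOf_succ, position_append, ih, move, if_neg h₁, if_neg h₂, if_pos one_lt_two]
  refine outcome_of_level (N := w.length) (l := if atom p c = true then 1 else 0) hn
    (fun k hk => ?_) (by split_ifs <;> omega) ?_
  · rw [hpos k hk]
    simp [level]
  · unfold chooser
    split_ifs
    · exact decide_eq_decide.2 (by omega)
    · rw [← decide_not]
      exact decide_eq_decide.2 (by omega)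

/-- Backward induction on the number `d` of moves `false` before a winning `true`. If one move of
the chooser leads to his best outcome, equilibrium forces that outcome at the current history too.
-/
theorem value_eq_best_of_choice (hs : (game n p).IsSubgamePerfect s) {j : ℕ} (hj : j + 1 ≤ n)
    {c : Question} (ih : ∀ w z c, position n w = (j + 1, z, c) → ¬ truthFrom p j z c →
      outcome n p (Game.play s w) = best (!chooser n j)) (d : ℕ) :
    ∀ w z, position n w = (j + 2, z, c) → ¬ truth p j (step c (z + d)) →
      outcome n p (Game.play s w) = best (chooser n (j + 1)) := by
  have key : ∀ w z b, position n w = (j + 2, z, c) →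
      outcome n p (Game.play s (w ++ [b])) = best (chooser n (j + 1)) →
      outcome n p (Game.play s w) = best (chooser n (j + 1)) := by
    intro w z b hw hb
    have := hs.not_pref_append w b
    rw [turn_eq_chooser hj hw] at this
    change ¬ (if chooser n (j + 1) = true then outcome n p (Game.play s (w ++ [b])) < _
      else _ < outcome n p (Game.play s (w ++ [b]))) at this
    rw [hb] at this
    exact eq_best_of_not_pref this
  induction d with
  | zero =>
    intro w z hw ht
    refine key w z true hw ?_
    rw [chooser_succ]
    exact ih _ _ _ (position_true hj hw) (by rwa [truthFrom_zero])
  | succ d ihd =>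
    intro w z hw ht
    refine key w z false hw (ihd _ _ (position_false hj hw) ?_)
    rwa [add_assoc, add_comm 1 d]

/-- Induction on the numbers still to be chosen. If no remaining number is good for the chooser, he
either stops at a losing one or never stops, and then the parity of the final level `j + 1` makes
him lose. -/
theorem value_eq (hn : 0 < n) (hs : (game n p).IsSubgamePerfect s) (j : ℕ) (hj : j ≤ n) :
    ∀ w z c, position n w = (j + 1, z, c) →
      (truthFrom p j z c → outcome n p (Game.play s w) = best (chooser n j)) ∧
      (¬ truthFrom p j z c → outcome n p (Game.play s w) = best (!chooser n j)) := by
  induction j with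
  | zero =>
    intro w z c hw
    have h := value_eq_of_answer (p := p) hn s hw
    refine ⟨fun ht => ?_, fun ht => ?_⟩
    · change atom p c = true at ht
      rwa [if_pos ht] at h
    · change ¬ atom p c = true at ht
      rwa [if_neg ht] at h
  | succ j ih =>
    have ih := ih (by omega)
    intro w z c hw
    constructor
    · rintro ⟨x, hx, ht⟩
      obtain ⟨d, rfl⟩ := Nat.exists_eq_add_of_le hx
      exact value_eq_best_of_choice hs hj (fun w z c hw => (ih w z c hw).2) d w z hw ht
    · intro ht
      have ht' : ∀ d, truth p j (step c (z + d)) := fun d => by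
        by_contra hd
        exact ht ⟨z + d, by omega, hd⟩
      have hpos : ∀ d, (∀ i, i < d → Game.play s w (w.length + i) = false) →
          position n (prefixOf (Game.play s w) (w.length + d)) = (j + 2, z + d, c) := by
        intro d
        induction d with
        | zero =>
          intro _
          rwa [add_zero, Game.prefixOf_play_length]
        | succ d ihd =>
          intro hi
          rw [← add_assoc, prefixOf_succ, hi d d.lt_succ_self]
          exact position_false hj (ihd fun i h => hi i (h.trans d.lt_succ_self))
      by_cases hex : ∃ d, Game.play s w (w.length + d) = true
      · classical
        have hd := Nat.find_spec hex
        have hmin : ∀ i, i < Nat.find hex → Game.play s w (w.length + i) = false := fun i hi => by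
          simpa using Nat.find_min hex hi
        generalize Nat.find hex = d at hd hmin
        have hu := hpos d hmin
        rw [Game.play_apply s w (by omega)] at hd
        rw [Game.prefixOf_play] at hu hd
        rw [← Game.play_historyFrom s w d, ← Game.play_append, hd, chooser_succ, Bool.not_not]
        exact (ih _ _ _ (position_true hj hu)).1 (by rw [truthFrom_zero]; exact ht' d)
      · have hall : ∀ d, Game.play s w (w.length + d) = false := fun d => by
          by_contra hd
          exact hex ⟨d, by simpa using hd⟩
        refine outcome_of_level (N := w.length) (l := j + 1) hn (fun k hk => ?_) hj ?_
        · obtain ⟨d, rfl⟩ := Nat.exists_eq_add_of_le hk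
          rw [hpos d fun i _ => hall i]
          have h₁ : j + 2 ≠ 0 := by omega
          have h₂ : j + 2 ≠ 1 := by omega
          have h₃ : j + 2 ≤ n + 1 := by omega
          refine ⟨h₁, ?_⟩
          rw [level, if_neg h₁, if_neg h₂, if_pos h₃]
          rfl
        · unfold chooser
          rw [← decide_not]
          exact decide_eq_decide.2 (by omega)

/-- In a subgame-perfect equilibrium, the first player chooses the neutral outcome exactly if the
answer to the question is negative. -/
theorem strategy_eq (hn : 0 < n) (hs : (game n p).IsSubgamePerfect s) {w : List Bool} {z : ℕ}
    {c : Question} (hw : position n w = (n + 2, z, c)) : s w = true ↔ ¬ truth p n c := by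
  have h₁ : n + 2 ≠ n + 3 := by omega
  have ht : position n (w ++ [true]) = (0, 0, c) := by
    rw [position_append, hw, move, if_neg h₁, if_pos rfl, if_pos rfl]
  have hf : position n (w ++ [false]) = (n + 1, 0, c) := by
    rw [position_append, hw, move, if_neg h₁, if_pos rfl, if_neg Bool.false_ne_true]
  have hturn : (game n p).turn w = false := by
    change turnOfPhase n (position n w).1 = _
    rw [hw, turnOfPhase, if_pos le_rfl]
  have hvt : outcome n p (Game.play s (w ++ [true])) = 1 :=
    outcome_of_neutral hn (N := (w ++ [true]).length) (by rw [Game.prefixOf_play_length, ht])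
  -- The first player chooses the first of the `n` numbers, hence plays for a positive answer.
  have hch : chooser n n = false := decide_eq_false (by omega)
  obtain ⟨hv, hv'⟩ := value_eq hn hs n le_rfl _ _ _ hf
  rw [truthFrom_zero, hch] at hv hv'
  have hpref : ∀ b, ¬ outcome n p (Game.play s w) < outcome n p (Game.play s (w ++ [b])) := by
    intro b
    have := hs.not_pref_append w b
    rwa [hturn] at this
  have hself := Game.play_append s w
  constructor
  · intro hsw htr
    rw [hsw] at hself
    have := hpref false
    rw [← hself, hvt, hv htr] at this
    exact this (by decide)
  · intro htr
    by_contra hsw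
    rw [Bool.not_eq_true] at hsw
    rw [hsw] at hself
    have := hpref true
    rw [← hself, hvt, hv' htr] at this
    exact this (by decide)

end LimGame

/-! ### Every name denotes a set of the class -/

theorem isOpen_cylinder (w : List Bool) : IsOpen (cylinder w) := by
  have : cylinder w = ⋂ i : Fin w.length, (fun x : Cantor => x i) ⁻¹' {w[i]} := by
    ext x
    simp only [cylinder, Set.mem_ofPred_eq, Set.mem_iInter, Set.mem_preimage,
      Set.mem_singleton_iff]
    exact ⟨fun h i => h i i.2, fun h i hi => h ⟨i, hi⟩⟩
  rw [this]
  exact isOpen_iInter_of_finite fun i =>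
    (isOpen_discrete _).preimage (continuous_apply (i : ℕ))

theorem isOpen_openOfName (p : Baire) : IsOpen (openOfName p) := by
  have : openOfName p = ⋃ (i : ℕ) (w : List Bool) (_ : p i = Encodable.encode w + 1),
      cylinder w := by
    ext x
    simp [openOfName]
  rw [this]
  exact isOpen_iUnion fun i => isOpen_iUnion fun w => isOpen_iUnion fun _ => isOpen_cylinder w

theorem diffOrCodiffOfName_mem (n : ℕ) (p : Baire) :
    diffOrCodiffOfName n p ∈ diffOrCodiffClass n := by
  have h : ∀ q, diffOfName n q ∈ diffClass n := fun q =>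
    ⟨_, fun i _ => isOpen_openOfName (q.sec i), rfl⟩
  unfold diffOrCodiffOfName
  split_ifs
  · exact Or.inl (h _)
  · right
    rw [compl_compl]
    exact h _

namespace LimGame

open NamedGame (wordOf)

/-! #### Names of the games -/

/-- The names of the level sets. -/
def openEntry (n : ℕ) (p : Baire) (m i j : ℕ) : ℕ :=
  if Encodable.encode (wordOf j) = j ∧ maskLevel n p m (wordOf j) ≤ i then j + 1 else 0

/-- The names of the outcome sets. -/
def setEntry (n : ℕ) (p : Baire) (m e : ℕ) : ℕ :=
  if e = 0 then maskFlag m else openEntry n p m (e - 1).unpair.1 (e - 1).unpair.2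

/-- The look-up table of the preferences. -/
def prefEntry (i : ℕ) : ℕ :=
  if i.unpair.1 = 0 then (if i.unpair.2.unpair.1 < i.unpair.2.unpair.2 then 1 else 0)
  else if i.unpair.2.unpair.2 < i.unpair.2.unpair.1 then 1 else 0

/-- The name of the game for `p`. -/
def gameName (n : ℕ) (p : Baire) : Baire := fun j =>
  if j.unpair.1 = 0 then 3
  else if j.unpair.1 = 1 then (turnOfPhase n (position n (wordOf j.unpair.2)).1).toNat
  else if j.unpair.1 = 2 then prefEntry j.unpair.2
  else setEntry n p j.unpair.2.unpair.1.unpair.2 j.unpair.2.unpair.2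

theorem openOfName_openEntry (n : ℕ) (p : Baire) (m i : ℕ) :
    openOfName (openEntry n p m i) = levelSet (maskLevel n p m) i := by
  ext x
  constructor
  · rintro ⟨j, w, hj, hx⟩
    unfold openEntry at hj
    split_ifs at hj with h
    obtain rfl : j = Encodable.encode w := by omega
    rw [NamedGame.wordOf_encode] at h
    refine ⟨w.length, ?_⟩
    rw [mem_cylinder_iff.1 hx]
    exact h.2
  · rintro ⟨k, hk⟩
    refine ⟨Encodable.encode (prefixOf x k), prefixOf x k, ?_, ?_⟩
    · rw [openEntry, NamedGame.wordOf_encode, if_pos ⟨rfl, hk⟩]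
    · rw [mem_cylinder_iff, length_prefixOf]

theorem mem_diffOrCodiffOfName (n : ℕ) (p : Baire) (m : ℕ) (x : Cantor) :
    x ∈ diffOrCodiffOfName n (setEntry n p m) ↔ (maskFlag m = 0 ↔ x ∈ maskDiff n p m) := by
  have h : diffOfName n (fun j => setEntry n p m (j + 1)) = maskDiff n p m := by
    refine diffSet_congr fun i _ => ?_
    rw [← openOfName_openEntry]
    congr 1
    funext j
    simp [Baire.sec, setEntry]
  have h0 : setEntry n p m 0 = maskFlag m := rfl
  rw [diffOrCodiffOfName, h, h0]
  split_ifs with hm <;> simp [hm]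

/-- Needed for the masks `0` and `7`: the constant level `n` presents the empty set, and the flag
turns it into the whole space for `7`. -/
theorem not_mem_maskDiff {n : ℕ} {p : Baire} {m : ℕ} (hm : ¬ (m = 4 ∨ m = 3))
    (hm' : ¬ (m = 6 ∨ m = 1)) (x : Cantor) : x ∉ maskDiff n p m := by
  classical
  have : firstIndex n (levelSet (maskLevel n p m)) x = n := by
    rw [firstIndex_eq_boundedFind]
    refine le_antisymm (boundedFind_le _ _) (not_lt.1 fun hlt => ?_)
    obtain ⟨i, hi, hx⟩ := boundedFind_lt_iff.1 hlt
    rw [decide_eq_true_eq] at hx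
    obtain ⟨k, hk⟩ := hx
    rw [maskLevel, if_neg hm, if_neg hm'] at hk
    omega
  simp [maskDiff, diffSet, this]

theorem diffOrCodiffOfName_eq {n : ℕ} {p : Baire} {m : ℕ} {a : Bool} (hm : m < 2 ^ 3)
    (h : (game n p).IsUpper a (Game.maskSet 3 m)) :
    diffOrCodiffOfName n (setEntry n p m) = (game n p).val ⁻¹' Game.maskSet 3 m := by
  ext x
  rw [mem_diffOrCodiffOfName]
  change _ ↔ m.testBit (outcome n p x) = true
  have h₄ := outcome_eq_two_iff (n := n) (p := p) (x := x)
  have h₆ := outcome_eq_zero_iff (n := n) (p := p) (x := x)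
  have e₃ : maskDiff n p 3 = maskDiff n p 4 := rfl
  have e₁ : maskDiff n p 1 = maskDiff n p 6 := rfl
  have hup : ∀ o o' : Fin 3, m.testBit o = true → (if a = true then o' < o else o < o') →
      m.testBit o' = true := h
  clear h
  -- The upper masks are `0`, `4`, `6`, `7` for the first player and `0`, `1`, `3`, `7` for the
  -- second; `2` and `5` are upper for neither.
  interval_cases m
  · simp [maskFlag, not_mem_maskDiff]
  · rw [e₁]
    generalize outcome n p x = o at h₄ h₆
    simp only [maskFlag]
    fin_cases o <;> simp_all <;> rfl
  · cases a
    · exact absurd (hup 1 2) (by decide)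
    · exact absurd (hup 1 0) (by decide)
  · rw [e₃]
    generalize outcome n p x = o at h₄ h₆
    simp only [maskFlag]
    fin_cases o <;> simp_all <;> rfl
  · generalize outcome n p x = o at h₄ h₆
    simp only [maskFlag]
    fin_cases o <;> simp_all <;> rfl
  · cases a
    · exact absurd (hup 0 1) (by decide)
    · exact absurd (hup 2 1) (by decide)
  · generalize outcome n p x = o at h₄ h₆
    simp only [maskFlag]
    fin_cases o <;> simp_all <;> rfl
  · generalize outcome n p x = o at h₄ h₆
    have := not_mem_maskDiff (n := n) (p := p) (m := 7) (by norm_num) (by norm_num) x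
    simp only [maskFlag]
    fin_cases o <;> simp_all <;> rfl

theorem inClass_game (n : ℕ) (p : Baire) : (game n p).InClass n := by
  intro a U hU
  obtain ⟨m, hm, rfl⟩ := Game.exists_mask U
  exact diffOrCodiffOfName_eq hm hU ▸ diffOrCodiffOfName_mem _ _

theorem names_game (n : ℕ) (p : Baire) : Game.Names n (gameName n p) (game n p) := by
  refine ⟨?_, ?_, ?_, ?_⟩
  · simp [Baire.sec, gameName, game]
  · intro w
    simp [Baire.sec, gameName, game]
  · intro a o o'
    have hgo : (game n p).pref a o o' ↔ if a = true then o' < o else o < o' := Iff.rfl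
    simp only [hgo]
    cases a <;> simp [Baire.sec, gameName, prefEntry]
  · intro a m hm h
    refine Eq.trans ?_ (diffOrCodiffOfName_eq hm h)
    congr 1
    funext j
    simp [Baire.sec, gameName]

/-! #### Computability of the names -/

theorem step_primrec : Primrec₂ step := by
  have hc : Primrec fun x : Question × ℕ => x.1 := Primrec.fst
  have hx : Primrec fun x : Question × ℕ => x.2.unpair := Primrec.unpair.comp Primrec.snd
  have h₂ := Primrec.snd.comp hc
  have h₃ := Primrec.snd.comp h₂
  exact Primrec.pair (Primrec₂.natPair.comp (Primrec.fst.comp hc) (Primrec.nat_add.comp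
    (Primrec.fst.comp h₂) (Primrec.fst.comp hx))) (Primrec.pair (Primrec.snd.comp hx)
      (Primrec.pair (Primrec.fst.comp h₃) (Primrec.not.comp (Primrec.snd.comp h₃))))

theorem questionOf_primrec : Primrec questionOf := by
  have h₂ := Primrec.unpair.comp (Primrec.snd.comp Primrec.unpair)
  exact Primrec.pair (Primrec.fst.comp Primrec.unpair) (Primrec.pair (Primrec.fst.comp h₂)
    (Primrec.pair (Primrec.snd.comp h₂) (Primrec.const true)))

theorem move_primrec (n : ℕ) : Primrec₂ (move n) := by
  have hs : Primrec fun x : Position × Bool => x.1 := Primrec.fst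
  have hf := Primrec.fst.comp hs
  have hz := Primrec.fst.comp (Primrec.snd.comp hs)
  have hc := Primrec.snd.comp (Primrec.snd.comp hs)
  have hb : PrimrecPred fun x : Position × Bool => x.2 = true :=
    Primrec.eq.comp Primrec.snd (Primrec.const true)
  have hz' := Primrec.succ.comp hz
  have h0 : Primrec fun _ : Position × Bool => 0 := Primrec.const 0
  refine Primrec.ite (Primrec.eq.comp hf (Primrec.const (n + 3)))
    (Primrec.ite hb ((Primrec.const (n + 2)).pair (h0.pair (questionOf_primrec.comp hz)))
      ((Primrec.const (n + 3)).pair (hz'.pair hc)))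
    (Primrec.ite (Primrec.eq.comp hf (Primrec.const (n + 2)))
      (Primrec.ite hb (h0.pair (h0.pair hc)) ((Primrec.const (n + 1)).pair (h0.pair hc)))
      (Primrec.ite (Primrec.nat_lt.comp hf (Primrec.const 2)) hs
        (Primrec.ite hb ((Primrec.pred.comp hf).pair (h0.pair (step_primrec.comp hc hz)))
          (hf.pair (hz'.pair hc)))))

theorem position_primrec (n : ℕ) : Primrec (position n) :=
  Primrec.list_foldl Primrec.id (Primrec.const _)
    ((move_primrec n).comp (Primrec.fst.comp Primrec.snd) (Primrec.snd.comp Primrec.snd)).to₂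

theorem turnOfPhase_primrec (n : ℕ) : Primrec (turnOfPhase n) :=
  Primrec.ite (Primrec.nat_le.comp (Primrec.const (n + 2)) Primrec.id) (Primrec.const false)
    (Primrec.eq.comp (Primrec.nat_mod.comp (Primrec.nat_add.comp Primrec.id (Primrec.const n))
      (Primrec.const 2)) (Primrec.const 0)).decide

theorem level_computable (n l : ℕ) : OracleComputable fun p s => level n p l s := by
  have hs : OracleComputable fun _ (s : Position) => s := .id
  have hc := hs.snd.snd
  have hat : OracleComputable fun p (s : Position) => atom p s.2.2 :=
    .map₂ (f := xor) (Primrec.dom_bool₂ xor) (.eq (.query hc.fst) hc.snd.snd.fst) hc.snd.snd.snd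
  exact .ite (.eq hs.fst (.const 0)) (.const l) (.ite (.eq hs.fst (.const 1))
    (.ite (.eq hat (.const true)) (.const 1) (.const 0))
    (.ite (.le hs.fst (.const (n + 1))) (hs.fst.map Primrec.pred) (.const n)))

theorem maskLevel_computable (n : ℕ) :
    OracleComputable fun p (x : ℕ × List Bool) => maskLevel n p x.1 x.2 := by
  have hid : OracleComputable fun _ (x : ℕ × List Bool) => x := .id
  have hp := hid.snd.map (position_primrec n)
  have hm : ∀ a b : ℕ, OracleComputable fun _ (x : ℕ × List Bool) => decide (x.1 = a ∨ x.1 = b) :=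
    fun a b => .or (.eq hid.fst (.const a)) (.eq hid.fst (.const b))
  exact .ite (hm 4 3) ((level_computable n n).comp hp)
    (.ite (hm 6 1) ((level_computable n (n - 1)).comp hp) (.const n))

theorem setEntry_computable (n : ℕ) :
    OracleComputable fun p (x : ℕ × ℕ) => setEntry n p x.1 x.2 := by
  have hid : OracleComputable fun _ (x : ℕ × ℕ) => x := .id
  have he := (hid.snd.map Primrec.pred).map Primrec.unpair
  have hw := he.snd.map NamedGame.wordOf_primrec
  have ho : OracleComputable fun p (x : ℕ × ℕ) =>
      openEntry n p x.1 (x.2 - 1).unpair.1 (x.2 - 1).unpair.2 :=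
    .ite (.and (.eq (.encode hw) he.snd) (.le ((maskLevel_computable n).app₂ hid.fst hw) he.fst))
      (he.snd.map Primrec.succ) (.const 0)
  have hflag : OracleComputable fun _ (x : ℕ × ℕ) => maskFlag x.1 :=
    .ite (.or (.eq hid.fst (.const 1)) (.or (.eq hid.fst (.const 3)) (.eq hid.fst (.const 7))))
      (.const 1) (.const 0)
  exact .ite (.eq hid.snd (.const 0)) hflag ho

theorem gameName_computable (n : ℕ) : OracleComputable (gameName n) := by
  have hid : OracleComputable fun _ (j : ℕ) => j := .id
  have hj := hid.map Primrec.unpair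
  have hi := hj.snd.map Primrec.unpair
  have ho := hi.snd.map Primrec.unpair
  have hpref : OracleComputable fun _ (j : ℕ) => prefEntry j.unpair.2 :=
    .ite (.eq hi.fst (.const 0)) (.ite (.lt ho.fst ho.snd) (.const 1) (.const 0))
      (.ite (.lt ho.snd ho.fst) (.const 1) (.const 0))
  have hturn : OracleComputable fun _ (j : ℕ) =>
      (turnOfPhase n (position n (wordOf j.unpair.2)).1).toNat :=
    .map (Primrec.dom_bool _) ((((hj.snd.map NamedGame.wordOf_primrec).map
      (position_primrec n)).fst).map (turnOfPhase_primrec n))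
  exact .ite (.eq hj.fst (.const 0)) (.const 3) (.ite (.eq hj.fst (.const 1)) hturn
    (.ite (.eq hj.fst (.const 2)) hpref
      ((setEntry_computable n).app₂ (hi.fst.map Primrec.unpair).snd hi.snd)))

/-! #### Reading off the limit -/

/-- The history at which the first player decides about the question with code `z`. -/
def decisionWord (z : ℕ) : List Bool := (List.range z).map (fun _ => false) ++ [true]

theorem position_decisionWord (n z : ℕ) :
    position n (decisionWord z) = (n + 2, 0, questionOf z) := by
  have h : position n ((List.range z).map fun _ => false) = (n + 3, z, 0, 0, 0, false) := by
    induction z with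
    | zero => rfl
    | succ z ih =>
      rw [List.range_succ, List.map_append, List.map_singleton, position_append, ih, move,
        if_pos rfl, if_neg Bool.false_ne_true]
  rw [decisionWord, position_append, h, move, if_pos rfl, if_pos rfl]

theorem decisionWord_primrec : Primrec decisionWord :=
  Primrec.list_concat.comp (Primrec.list_map Primrec.list_range (Primrec.const false).to₂)
    (Primrec.const true)

/-- The position of the strategy's answer in a pair of a point and the name of a strategy. -/
def answerIndex (m j : ℕ) : ℕ := 2 * Encodable.encode (decisionWord (Nat.pair m j)) + 1

/-- The values of the iterated limit that are given by the negative answers. -/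
def readLimit (r : Baire) : Set Baire :=
  {q | ∀ m, (∃ j, r (answerIndex m j) = 1) ∧
    ∀ j, r (answerIndex m j) = 1 → q m = j.unpair.2}

theorem readLimit_unique {r q q' : Baire} (h : q ∈ readLimit r) (h' : q' ∈ readLimit r) :
    q' = q := by
  funext m
  obtain ⟨⟨j, hj⟩, hq⟩ := h m
  rw [hq j hj, (h' m).2 j hj]

/-- Every entry `1` reveals the correct value, so the first one found will do. -/
theorem readLimit_computable : ComputableOnBaire (relSelect readLimit) := by
  let J : List ℕ → ℕ → ℕ := fun w m =>
    boundedFind (fun j => decide (w[answerIndex m j]? = some 1)) w.length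
  refine ⟨fun w m => if J w m < w.length then some (J w m).unpair.2 else none, ?_, ?_⟩
  · have hid : OracleComputable fun _ (x : List ℕ × ℕ) => x := .id
    have h₂ : OracleComputable fun _ (x : (List ℕ × ℕ) × ℕ) => x := .id
    have hindex : OracleComputable fun _ (x : (List ℕ × ℕ) × ℕ) => answerIndex x.1.2 x.2 :=
      .map (f := fun n : ℕ => 2 * n + 1) Primrec.nat_double_succ (.encode (.map decisionWord_primrec
        (.natPair h₂.fst.snd h₂.snd)))
    have hlen : OracleComputable fun _ (x : List ℕ × ℕ) => x.1.length :=
      .map Primrec.list_length hid.fst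
    have hJ : OracleComputable fun _ (x : List ℕ × ℕ) => J x.1 x.2 :=
      .boundedFind (P := fun _ (x : (List ℕ × ℕ) × ℕ) =>
        decide (x.1.1[answerIndex x.1.2 x.2]? = some 1))
        (.eq (.map₂ Primrec.list_getElem? h₂.fst.fst hindex) (.const _)) hlen
    have := OracleComputable.ite (.lt hJ hlen)
      (.map Primrec.option_some (hJ.map Primrec.unpair).snd) (.const none)
    exact this.computable
  · intro r q hq m
    have hq := relSelect_mem hq
    have hcorrect : ∀ k b, (if J (r.initSeg k) m < (r.initSeg k).length then
        some (J (r.initSeg k) m).unpair.2 else none) = some b → b = q m := by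
      intro k b hb
      split_ifs at hb with hlt
      have hs := of_decide_eq_true (boundedFind_spec hlt)
      obtain rfl := Option.some.inj hb
      refine ((hq m).2 _ ?_).symm
      obtain ⟨hi, he⟩ := List.getElem?_eq_some_iff.1 hs
      rw [← he]
      simp [Baire.initSeg, J]
    refine ⟨?_, hcorrect⟩
    obtain ⟨⟨j, hj⟩, -⟩ := hq m
    have hlt : J (r.initSeg (max j (answerIndex m j) + 1)) m <
        (r.initSeg (max j (answerIndex m j) + 1)).length := by
      refine boundedFind_lt_iff.2 ⟨j, by simp, ?_⟩
      rw [r.getElem?_initSeg (by omega), hj, decide_eq_true rfl]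
    refine ⟨max j (answerIndex m j) + 1, ?_⟩
    have := hcorrect (max j (answerIndex m j) + 1) _ (if_pos hlt)
    dsimp only
    rw [if_pos hlt, this]

/-- The questions carry the flag `true`, so they ask whether some `y ⟨m, i⟩` with `i ≥ t` differs
from `k`. The first player's neutral choice denies this, which means that row `m` of `y` is
constantly `k` from `t` on. -/
theorem mem_readLimit {n : ℕ} {p q t : Baire} {s : List Bool → Bool} (hq : q ∈ limPow (n + 1) p)
    (hs : (game (n + 1) p).IsSubgamePerfect s) (ht : profileSpace.Names t s) :
    q ∈ readLimit (Baire.join p t) := by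
  obtain ⟨y, hy, hlim⟩ := mem_limPow_succ'.1 hq
  have key : ∀ m j, Baire.join p t (answerIndex m j) = 1 ↔
      ∀ i, j.unpair.1 ≤ i → y (Nat.pair m i) = j.unpair.2 := by
    intro m j
    have h₁ := ht (decisionWord (Nat.pair m j))
    rw [answerIndex, Baire.join_odd, h₁]
    have h₂ := strategy_eq n.succ_pos hs (position_decisionWord (n + 1) (Nat.pair m j))
    rw [questionOf, truth_succ_iff hy] at h₂
    have h₃ : (s (decisionWord (Nat.pair m j))).toNat = 1 ↔
        s (decisionWord (Nat.pair m j)) = true := by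
      cases s (decisionWord (Nat.pair m j)) <;> simp
    rw [h₃, h₂]
    simp
  intro m
  obtain ⟨N, hN⟩ := eventually_atTop.1 (hlim m)
  refine ⟨⟨Nat.pair N (q m), (key _ _).2 fun i hi => ?_⟩, fun j hj => ?_⟩
  · rw [Nat.unpair_pair] at hi ⊢
    exact hN i hi
  · have h₁ := (key m j).1 hj (max N j.unpair.1) (le_max_right _ _)
    rw [← h₁]
    exact (hN _ (le_max_left _ _)).symm

end LimGame

/-! ### The lower bound and the equivalence -/

theorem limPow_weihrauchLE_SPE (n : ℕ) : (limPow n).WeihrauchLE (SPE n) := by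
  have hH : ComputableOnBaire fun p => Part.some (LimGame.gameName n p) :=
    (RelComputable.of_oracle (LimGame.gameName_computable n)).computableOnBaire
      fun _ _ h => Part.mem_some_iff.1 h
  have hname : ∀ p, (gameSpace n).Names (LimGame.gameName n p)
      ⟨LimGame.game n p, LimGame.inClass_game n p⟩ := LimGame.names_game n
  cases n with
  | zero =>
    -- For `n = 0` the equilibrium is ignored; the game only has to be a legitimate instance.
    refine ⟨fun r => Part.some (NamedGame.evens r), _,
      (RelComputable.of_oracle NamedGame.evens_computable).computableOnBaire
        fun _ _ h => Part.mem_some_iff.1 h, hH, ?_⟩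
    rintro G hG p _ rfl -
    obtain ⟨t, ht, -, -, -⟩ := hG _ _ (hname p) (SPE_nonempty 0 _)
    refine ⟨p, Part.mem_bind_iff.2 ⟨_, Part.mem_some _, Part.mem_bind_iff.2 ⟨t, ht, ?_⟩⟩,
      p, rfl, rfl⟩
    rw [Part.mem_some_iff, NamedGame.evens_join]
  | succ n =>
    refine ⟨_, _, LimGame.readLimit_computable, hH, ?_⟩
    rintro G hG p _ rfl ⟨q, hq⟩
    obtain ⟨t, ht, s, hs, hts⟩ := hG _ _ (hname p) (SPE_nonempty (n + 1) _)
    have hmem := LimGame.mem_readLimit hq hs hts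
    exact ⟨q, Part.mem_bind_iff.2 ⟨_, Part.mem_some _, Part.mem_bind_iff.2 ⟨t, ht,
      mem_relSelect hmem fun q' hq' => LimGame.readLimit_unique hmem hq'⟩⟩, q, hq, rfl⟩

theorem theorem31 (n : ℕ) :
    (∀ G, (SPE n G).Nonempty) ∧
    IsStarPower limBaire n (limPow n) ∧
    (SPE n).WeihrauchEquiv (limPow n) := by
  exact ⟨SPE_nonempty n, isStarPower_limPow n, SPE_weihrauchLE n, limPow_weihrauchLE_SPE n⟩
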